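/- **Setting and notation.** Let $X\neq\{0\}$ be a complex Banach space. For a Banach space $Y$ let $\ell^2(\mathbb Z,Y)$ carry the norm $(\sum_j\|y_j\|^2)^{1/2}$ and let $Y^b$ carry the norm $(\sum_{j=1}^b\|\xi_j\|^2)^{1/2}$. An operator $B\in L(\ell^2(\mathbb Z,Y))$ has matrix entries $b_{i,j}\in L(Y)$, $i,j\in\mathbb Z$; it is banded with band-width $w$ if $b_{i,j}=0$ for $|i-j|>w$, tridiagonal if it is banded with band-width $1$, and band-dominated if it is in the operator norm closure of the banded operators. For an operator $B$ between Banach spaces let $\nu(B)=\inf_{\|x\|=1}\|Bx\|$, and let $B^*$ be the Banach space adjoint. For $B\in L(Y)$ let $\mathrm{Spec}_0 B=\mathrm{Spec}\,B$ and, for $\varepsilon>0$, $\mathrm{Spec}_\varepsilon B=\{\lambda\in\mathbb C: 1/\|(B-\lambda I)^{-1}\|\le\varepsilon\}$, where $1/\|(B-\lambda I)^{-1}\|:=0$ if $B-\lambda I$ is not invertible. Write $S_n\to S$ (Hausdorff) if all the sets are bounded and non-empty and their Hausdorff distance $d_H(S_n,S)$ tends to $0$. Below, $\mathbb N=\{1,2,\dots\}$.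 Let $n\in\mathbb N$, $k\in\mathbb Z$. Let $E_{n,k}$ be the subspace of $\ell^2(\mathbb Z,Y)$ of sequences supported on $\{k+1,\dots,k+n\}$; in the dual space, which is $\ell^2(\mathbb Z,Y^*)$, the same symbol denotes the functionals that depend on these coordinates only. For $B\in L(\ell^2(\mathbb Z,Y))$ let $B^+_{n,k}:Y^n\to Y^{n+2}$ be the $(n+2)\times n$ matrix formed by rows $k,\dots,k+n+1$ and columns $k+1,\dots,k+n$ of $B$, and let $(B^*)^+_{n,k}:(Y^*)^n\to (Y^*)^{n+2}$ be formed in the same way from the matrix $[b_{j,i}^*]$ of $B^*$. Let $I_n^+$ be the $n\times n$ identity matrix with a zero row added at the top and at the bottom. For a finite non-empty $K_n\subset\mathbb Z$ let $$\mu_n^{\mathrm{fin}}(B)=\min_{k\in K_n}\min\big(\nu(B|_{E_{n,k}}),\nu(B^*|_{E_{n,k}})\big),\qquad \Gamma^{n,\mathrm{fin}}_\varepsilon(B)=\{\lambda\in\mathbb C:\mu^{\mathrm{fin}}_n(B-\lambda I)\le\varepsilon\},$$ and let $\varepsilon''_n(B)=2\big(\sup_i\|b_{i,i+1}\|+\sup_i\|b_{i,i-1}\|\big)\sin\frac{\pi}{2(n+1)}$.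 **Theorem.** Let $A\in L(\ell^2(\mathbb Z,X))$ be band-dominated, with matrix entries $a_{i,j}$ such that $\{a_{i,j}:i,j\in\mathbb Z\}\subset L(X)$ is relatively compact. If $A$ is tridiagonal put $A^{(n)}=A$ for all $n\in\mathbb N$; otherwise let $A^{(n)}$ be the operator with matrix entries $\big(1-\frac{|i-j|}{n+1}\big)^{\mathfrak p}a_{i,j}$ for $|i-j|\le n$ and $0$ for $|i-j|>n$, for some fixed $\mathfrak p\ge0$ such that $\|A-A^{(n)}\|\to0$. Let $\delta_n=\|A-A^{(n)}\|$. Let $w_n\in\mathbb N$ be such that $A^{(n)}$ is banded with band-width $w_n$, and let $A_n=\mathcal I_{w_n}A^{(n)}\mathcal I_{w_n}^{-1}$, where $\mathcal I_b:\ell^2(\mathbb Z,X)\to\ell^2(\mathbb Z,X^b)$ is the isometric isomorphism $x\mapsto\big((x_{bi+1},\dots,x_{b(i+1)})\big)_{i\in\mathbb Z}$. Let $(\eta_n)$ be either a positive null sequence or, in the case that $X$ is finite-dimensional or a Hilbert space, $\eta_n=0$ for all $n$. Then: 1. For every $n\in\mathbb N$ there is a finite set $K_n\subset\mathbb Z$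 such that for every $k\in\mathbb Z$ there is $j\in K_n$ with $$\|(A_n)^+_{n,k}-(A_n)^+_{n,j}\|\le 1/n\quad\text{and}\quad\|((A_n)^*)^+_{n,k}-((A_n)^*)^+_{n,j}\|\le 1/n .\qquad(*)$$ 2. For every $n\in\mathbb N$ and every finite $K_n\subset\mathbb Z$ with the property $(*)$: for all $\lambda\in\mathbb C$, $$\mu_n^{\mathrm{fin}}(A_n-\lambda I)=\min_{j\in K_n}\min\Big(\nu\big((A_n)^+_{n,j}-\lambda I_n^+\big),\ \nu\big(((A_n)^*)^+_{n,j}-\lambda I_n^+\big)\Big),$$ and for all $\varepsilon\ge0$, $$\Gamma^{n,\mathrm{fin}}_\varepsilon(A_n)\subset\mathrm{Spec}_{\varepsilon+\delta_n+\eta_n}A\quad\text{and}\quad \mathrm{Spec}_\varepsilon A\subset\Gamma^{n,\mathrm{fin}}_{\varepsilon+\delta_n+\eta_n+\varepsilon''_n(A_n)+1/n}(A_n).$$ 3. For every choice of finite sets $K_n$, $n\in\mathbb N$, with the property $(*)$, and every $\varepsilon\ge0$, as $n\to\infty$, in the Hausdorff metric, $$\Gamma^{n,\mathrm{fin}}_{\varepsilon+2\delta_n+2\eta_n+\varepsilon''_n(A_n)+1/n}(A_n)\to\mathrm{Spec}_\varepsilon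 A;\quad\text{in particular}\quad \Gamma^{n,\mathrm{fin}}_{\varepsilon''_n(A_n)+2\delta_n+2\eta_n+1/n}(A_n)\to\mathrm{Spec}\,A.$$ -/

import Mathlib

open Set Filter Topology
open scoped ENNReal

noncomputable section

namespace BandDom

/-! ### Lower norms, pseudospectra, Hausdorff convergence -/

section General

variable {V W : Type*} [NormedAddCommGroup V] [NormedSpace ℂ V]
  [NormedAddCommGroup W] [NormedSpace ℂ W]

/-- The lower norm `ν(B) = inf {‖B x‖ : ‖x‖ = 1}`. -/
def lowerNorm (B : V →L[ℂ] W) : ℝ :=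
  sInf ((fun x => ‖B x‖) '' {x : V | ‖x‖ = 1})

/-- The lower norm `ν(B|_Z)` of the restriction of `B` to a subspace `Z`. -/
def lowerNormOn (B : V →L[ℂ] W) (Z : Submodule ℂ V) : ℝ :=
  lowerNorm (B ∘L Z.subtypeL)

/-- The Banach space adjoint `B* : W* → V*`, `f ↦ f ∘ B`. -/
def dual (B : V →L[ℂ] W) : StrongDual ℂ W →L[ℂ] StrongDual ℂ V :=
  B.precomp ℂ

open Classical in
/-- `1 / ‖B⁻¹‖`, with the convention that this is `0` if `B` is not invertible. -/
def recipNormInv (B : V →L[ℂ] V) : ℝ :=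
  if IsUnit B then 1 / ‖Ring.inverse B‖ else 0

/-- `B - λ I`. -/
def subScalar (B : V →L[ℂ] V) (z : ℂ) : V →L[ℂ] V :=
  B - z • ContinuousLinearMap.id ℂ V

/-- The closed `ε`-pseudospectrum, `{λ : 1 / ‖(B - λ I)⁻¹‖ ≤ ε}` for `ε > 0`; for `ε = 0` it is by
convention the spectrum. -/
def pseudospectrum (ε : ℝ) (B : V →L[ℂ] V) : Set ℂ :=
  if ε = 0 then spectrum ℂ B
  else {z : ℂ | recipNormInv (subScalar B z) ≤ ε}

/-- `S n → T` in the Hausdorff metric, where all the sets (for `n = 1, 2, …`) are bounded and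
non-empty. The distance is `ℝ≥0∞`-valued. -/
def HausdorffTendsto (S : ℕ → Set ℂ) (T : Set ℂ) : Prop :=
  (∀ n, 1 ≤ n → Bornology.IsBounded (S n) ∧ (S n).Nonempty) ∧
  Bornology.IsBounded T ∧ T.Nonempty ∧
  Tendsto (fun n => Metric.hausdorffEDist (S n) T) atTop (𝓝 0)

/-- The norm of `V` is that of a Hilbert space: it comes from an inner product (compatible with the
given scalar multiplication). -/
def IsHilbertNorm (V : Type*) [NormedAddCommGroup V] [inst : NormedSpace ℂ V] : Prop :=
  ∃ H : InnerProductSpace ℂ V, H.toNormedSpace = inst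

end General

/-! ### Operators on `ℓ²(ℤ, Y)` and their matrices -/

section Ell

variable {Y : Type*} [NormedAddCommGroup Y] [NormedSpace ℂ Y]

/-- The space `ℓ²(ℤ, Y)`. -/
abbrev Ell (Y : Type*) [NormedAddCommGroup Y] : Type _ := lp (fun _ : ℤ => Y) 2

/-- `L(ℓ²(ℤ, Y))`, the bounded linear operators on `ℓ²(ℤ, Y)`. -/
abbrev Op (Y : Type*) [NormedAddCommGroup Y] [NormedSpace ℂ Y] : Type _ := Ell Y →L[ℂ] Ell Y

/-- The coordinate map `x ↦ x_j`. -/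
def coord (j : ℤ) : Ell Y →L[ℂ] Y :=
  LinearMap.mkContinuous
    { toFun := fun x => x j
      map_add' := fun _ _ => rfl
      map_smul' := fun _ _ => rfl } 1
    (fun x => by rw [one_mul]; exact lp.norm_apply_le_norm two_ne_zero x j)

/-- The embedding of `Y` as the `j`-th coordinate. -/
def embed (j : ℤ) : Y →L[ℂ] Ell Y :=
  lp.singleContinuousLinearMap ℂ (fun _ : ℤ => Y) 2 j

/-- The matrix entry `a_{i,j} ∈ L(Y)` of an operator on `ℓ²(ℤ, Y)`. -/
def entry (B : Op Y) (i j : ℤ) : Y →L[ℂ] Y :=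
  coord i ∘L B ∘L embed j

/-- `B` is banded with band-width `w`. -/
def HasBandwidth (B : Op Y) (w : ℕ) : Prop :=
  ∀ i j : ℤ, (w : ℤ) < |i - j| → entry B i j = 0

/-- `B` is tridiagonal. -/
def IsTridiagonal (B : Op Y) : Prop := HasBandwidth B 1

/-- `BO(ℓ²(ℤ, Y))`, the banded operators. -/
def bandedOps (Y : Type*) [NormedAddCommGroup Y] [NormedSpace ℂ Y] :
    Set (Op Y) :=
  {B | ∃ w : ℕ, HasBandwidth B w}

/-- `BDO(ℓ²(ℤ, Y))`, the band-dominated operators: the operator norm closure of the banded ones. -/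
def bandDominatedOps (Y : Type*) [NormedAddCommGroup Y] [NormedSpace ℂ Y] :
    Set (Op Y) :=
  closure (bandedOps Y)

/-- `r(B) = sup_i ‖a_{i,i+1}‖ + sup_i ‖a_{i,i-1}‖`. -/
def offDiag (B : Op Y) : ℝ :=
  (⨆ i : ℤ, ‖entry B i (i + 1)‖) + ⨆ i : ℤ, ‖entry B i (i - 1)‖

/-- The penalty term `ε''_n(B) = 2 r(B) sin (π / (2 (n + 1)))`. -/
def penalty (n : ℕ) (B : Op Y) : ℝ :=
  2 * offDiag B * Real.sin (Real.pi / (2 * ((n : ℝ) + 1)))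

/-- The projection `P_{n,k}` onto the coordinates `k + 1, …, k + n`. -/
def proj (n : ℕ) (k : ℤ) : Op Y :=
  ∑ j ∈ Finset.Icc (k + 1) (k + n), embed j ∘L coord j

/-- `E_{n,k}`, the range of `P_{n,k}`. -/
def sectionSpace (Y : Type*) [NormedAddCommGroup Y] [NormedSpace ℂ Y] (n : ℕ) (k : ℤ) :
    Submodule ℂ (Ell Y) :=
  LinearMap.range (proj n k : Op Y).toLinearMap

/-- The counterpart of `E_{n,k}` in the dual space: the range of `P_{n,k}*`, i.e. the functionals
that only depend on the coordinates `k + 1, …, k + n`. -/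
def dualSectionSpace (Y : Type*) [NormedAddCommGroup Y] [NormedSpace ℂ Y] (n : ℕ) (k : ℤ) :
    Submodule ℂ (StrongDual ℂ (Ell Y)) :=
  LinearMap.range (dual (proj n k : Op Y)).toLinearMap

/-- `μ_n^fin(B) = min_{k ∈ K} min (ν(B|_{E_{n,k}}), ν(B*|_{E_{n,k}}))`, for a finite non-empty
index set `K`. -/
def muFin (n : ℕ) (K : Finset ℤ) (B : Op Y) : ℝ :=
  ⨅ k : {k : ℤ // k ∈ K},
    min (lowerNormOn B (sectionSpace Y n k)) (lowerNormOn (dual B) (dualSectionSpace Y n k))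

/-- `Γ^{n,fin}_ε(B) = {λ : μ_n^fin(B - λ I) ≤ ε}`. -/
def GammaFin (n : ℕ) (K : Finset ℤ) (ε : ℝ) (B : Op Y) : Set ℂ :=
  {z : ℂ | muFin n K (subScalar B z) ≤ ε}

end Ell

/-! ### Finite operator matrices and one-sided truncations -/

section Finite

variable {Y : Type*} [NormedAddCommGroup Y] [NormedSpace ℂ Y]

/-- `Yᵇ` with the norm `(∑ ‖ξ_j‖²)^{1/2}`. -/
abbrev Pow (Y : Type*) [NormedAddCommGroup Y] (b : ℕ) : Type _ := PiLp 2 (fun _ : Fin b => Y)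

/-- The operator `Yⁿ → Yᵐ` given by an `m × n` matrix of operators on `Y`. -/
def ofEntries {m n : ℕ} (M : Fin m → Fin n → (Y →L[ℂ] Y)) : Pow Y n →L[ℂ] Pow Y m :=
  (PiLp.continuousLinearEquiv 2 ℂ (fun _ : Fin m => Y)).symm.toContinuousLinearMap ∘L
    ContinuousLinearMap.pi
      (fun r => ∑ c, M r c ∘L PiLp.proj (𝕜 := ℂ) 2 (fun _ : Fin n => Y) c)

/-- `B⁺_{n,k}`: the `(n + 2) × n` matrix formed by the rows `k, …, k + n + 1` and the columns
`k + 1, …, k + n` of `B`. -/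
def truncPlus (n : ℕ) (k : ℤ) (B : Op Y) : Pow Y n →L[ℂ] Pow Y (n + 2) :=
  ofEntries fun r c => entry B (k + (r : ℕ)) (k + 1 + (c : ℕ))

/-- `(B*)⁺_{n,k}`: the same rows and columns of the matrix of `B*`, whose `(i, j)` entry is
`a_{j,i}* ∈ L(Y*)`. -/
def truncPlusDual (n : ℕ) (k : ℤ) (B : Op Y) :
    Pow (StrongDual ℂ Y) n →L[ℂ] Pow (StrongDual ℂ Y) (n + 2) :=
  ofEntries fun r c => dual (entry B (k + 1 + (c : ℕ)) (k + (r : ℕ)))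

/-- `I⁺_n`: the `n × n` identity matrix with a zero row added at the top and at the bottom. -/
def idPlus (Y : Type*) [NormedAddCommGroup Y] [NormedSpace ℂ Y] (n : ℕ) :
    Pow Y n →L[ℂ] Pow Y (n + 2) :=
  ofEntries fun r c => if (r : ℕ) = (c : ℕ) + 1 then ContinuousLinearMap.id ℂ Y else 0

/-- `min_{j ∈ K} min (ν(B⁺_{n,j} - λ I⁺_n), ν((B*)⁺_{n,j} - λ I⁺_n))`, for a finite non-empty index
set `K`. -/
def muFinMat (n : ℕ) (K : Finset ℤ) (B : Op Y) (z : ℂ) : ℝ :=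
  ⨅ j : {j : ℤ // j ∈ K},
    min (lowerNorm (truncPlus n j B - z • idPlus Y n))
      (lowerNorm (truncPlusDual n j B - z • idPlus (StrongDual ℂ Y) n))

/-- Every pair `(B⁺_{n,k}, (B*)⁺_{n,k})`, `k ∈ ℤ`, is within `1 / n` of one with index in `K`. -/
def IsNet (n : ℕ) (K : Finset ℤ) (B : Op Y) : Prop :=
  ∀ k : ℤ, ∃ j ∈ K, ‖truncPlus n k B - truncPlus n j B‖ ≤ 1 / (n : ℝ) ∧
    ‖truncPlusDual n k B - truncPlusDual n j B‖ ≤ 1 / (n : ℝ)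

end Finite

/-! ### Regrouping into blocks -/

section Block

variable {X : Type*} [NormedAddCommGroup X] [NormedSpace ℂ X]

/-- The bijection `(i, m) ↦ b i + 1 + m` from `ℤ × {0, …, b - 1}` to `ℤ`. -/
def blockIndex (b : ℕ) [NeZero b] : ℤ × Fin b ≃ ℤ :=
  (Int.divModEquiv b).symm.trans (Equiv.addRight 1)

theorem blockIndex_apply (b : ℕ) [NeZero b] (i : ℤ) (m : Fin b) :
    blockIndex b (i, m) = (b : ℤ) * i + 1 + (m : ℕ) := by
  simp [blockIndex, Int.divModEquiv]
  ring

theorem memℓp_iff_sq {Z : Type*} [NormedAddCommGroup Z] (f : ℤ → Z) :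
    Memℓp f 2 ↔ Summable fun i => ‖f i‖ ^ 2 := by
  rw [memℓp_gen_iff (by norm_num)]
  simp

theorem norm_sq_eq_tsum {Z : Type*} [NormedAddCommGroup Z] (f : Ell Z) :
    ‖f‖ ^ 2 = ∑' i, ‖f i‖ ^ 2 := by
  simpa using lp.norm_rpow_eq_tsum (p := 2) (by norm_num) f

theorem block_norm_sq {Z : Type*} [NormedAddCommGroup Z] {b : ℕ} (v : Fin b → Z) :
    ‖(WithLp.toLp 2 v : Pow Z b)‖ ^ 2 = ∑ m, ‖v m‖ ^ 2 := by
  rw [PiLp.norm_sq_eq_of_L2]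

theorem memℓp_block_iff {Z : Type*} [NormedAddCommGroup Z] (b : ℕ) [NeZero b] (x : ℤ → Z) :
    Memℓp (fun i : ℤ => (WithLp.toLp 2 fun m : Fin b => x (blockIndex b (i, m)) : Pow Z b)) 2 ↔
      Memℓp x 2 := by
  rw [memℓp_iff_sq, memℓp_iff_sq, ← (blockIndex b).summable_iff (f := fun i => ‖x i‖ ^ 2)]
  have h := summable_prod_of_nonneg (f := fun p : ℤ × Fin b => ‖x (blockIndex b p)‖ ^ 2)
    (fun _ => by simp)
  simp only [block_norm_sq]
  simp only [tsum_fintype] at h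
  exact ⟨fun hs => h.2 ⟨fun _ => Summable.of_finite, hs⟩, fun hs => (h.1 hs).2⟩

theorem norm_block {Z : Type*} [NormedAddCommGroup Z] (b : ℕ) [NeZero b] (x : Ell Z)
    (ξ : Ell (Pow Z b)) (h : ∀ i, ξ i = WithLp.toLp 2 fun m => x (blockIndex b (i, m))) :
    ‖ξ‖ = ‖x‖ := by
  have hs : Summable fun p => ‖x (blockIndex b p)‖ ^ 2 :=
    ((blockIndex b).summable_iff (f := fun i => ‖x i‖ ^ 2)).2
      ((memℓp_iff_sq fun i => x i).1 (lp.memℓp x))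
  have h1 : ‖x‖ ^ 2 = ∑' i, ∑ m, ‖x (blockIndex b (i, m))‖ ^ 2 := by
    rw [norm_sq_eq_tsum x, ← (blockIndex b).tsum_eq (fun i => ‖x i‖ ^ 2), hs.tsum_prod]
    exact tsum_congr fun i => tsum_fintype _
  have h2 : ‖ξ‖ ^ 2 = ∑' i, ∑ m, ‖x (blockIndex b (i, m))‖ ^ 2 := by
    rw [norm_sq_eq_tsum ξ]
    exact tsum_congr fun i => by rw [h, block_norm_sq]
  exact (sq_eq_sq₀ (norm_nonneg _) (norm_nonneg _)).1 (h2.trans h1.symm)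

/-- The isometric isomorphism `𝓘_b : ℓ²(ℤ, X) → ℓ²(ℤ, Xᵇ)`, `x ↦ ξ`, with
`ξ_i = (x_{bi+1}, …, x_{b(i+1)})`. -/
def blockIso (X : Type*) [NormedAddCommGroup X] [NormedSpace ℂ X] (b : ℕ) [NeZero b] :
    Ell X ≃ₗᵢ[ℂ] Ell (Pow X b) where
  toFun x := ⟨fun i => WithLp.toLp 2 fun m => x (blockIndex b (i, m)),
    (memℓp_block_iff b _).2 x.2⟩
  invFun ξ := ⟨fun j => ξ ((blockIndex b).symm j).1 ((blockIndex b).symm j).2,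
    (memℓp_block_iff b _).1 (by
      simp only [Equiv.symm_apply_apply]
      exact ξ.2)⟩
  map_add' _ _ := rfl
  map_smul' _ _ := rfl
  left_inv x := by
    ext j
    simp
  right_inv ξ := by
    ext i m
    simp
  norm_map' x := norm_block b x _ fun _ => rfl

theorem blockIso_apply (b : ℕ) [NeZero b] (x : Ell X) (i : ℤ) (m : Fin b) :
    (blockIso X b x i) m = x ((b : ℤ) * i + 1 + (m : ℕ)) := by
  rw [← blockIndex_apply]; rfl

/-- `𝓘_b B 𝓘_b⁻¹`, i.e. the operator `B` rewritten as an operator on `ℓ²(ℤ, Xᵇ)`. -/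
def regroup (b : ℕ) [NeZero b] (B : Op X) :
    Op (Pow X b) :=
  (blockIso X b).toContinuousLinearEquiv.toContinuousLinearMap ∘L B ∘L
    (blockIso X b).symm.toContinuousLinearEquiv.toContinuousLinearMap

/-- The sequence `An = A^{(n)}` (`n = 1, 2, …`) of banded approximations: `A^{(n)} = A` if `A` is
tridiagonal; otherwise, for some `p ≥ 0`, `A^{(n)}` is the operator with the matrix entries
`(1 - |i - j| / (n + 1))ᵖ a_{i,j}` for `|i - j| ≤ n` and `0` for `|i - j| > n`. (An operator on
`ℓ²(ℤ, X)` is determined by its matrix.) -/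
def IsBandedApprox (A : Op X) (An : ℕ → Op X) : Prop :=
  (IsTridiagonal A ∧ ∀ n, 1 ≤ n → An n = A) ∨
  (¬ IsTridiagonal A ∧ ∃ p : ℝ, 0 ≤ p ∧ ∀ n, 1 ≤ n → ∀ i j : ℤ,
    entry (An n) i j =
      if |i - j| ≤ (n : ℤ) then
        ((((1 - ((|i - j| : ℤ) : ℝ) / ((n : ℝ) + 1)) ^ p : ℝ) : ℂ)) • entry A i j
      else 0)

end Block

end BandDom

end

/-!
The reciprocal `1 / ‖B⁻¹‖` equals `min (ν B) (ν B*)`, also when `B` is not invertible, so it is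
1-Lipschitz in `B` and bounded above by the lower norms of `B` and `B*` on all sections `E_{n,k}`.
Conversely, let `B` be tridiagonal and multiply `x` by all translates of the weight
`m ↦ sin (m π / (n + 1))`, supported on `{1, …, n}`. The squared norms of the localized sequences
add up, and the commutators of `B` with the weights are controlled by the increments of the
weight, which gives `inf_k ν(B|_{E_{n,k}}) ≤ ν B + ε''_n(B)`; the same holds for `B*`, which is
again tridiagonal under the identification `ℓ²(ℤ, Y)* = ℓ²(ℤ, Y*)`.

On `E_{n,k}` a tridiagonal operator acts as the matrix `B⁺_{n,k}`. Regrouping into blocks makes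
every banded operator tridiagonal, and the matrices `(A_n)⁺_{n,k}` have entries in a compact set,
hence finite nets exist and cost `1 / n`. Finally the sublevel sets of `λ ↦ 1 / ‖(A - λ)⁻¹‖` are
compact, so `Spec_{ε'} A` shrinks to `Spec_ε A` as `ε' ↓ ε`, and the two inclusions imply
Hausdorff convergence.
-/

noncomputable section

namespace BandDom

/-! ### Lower norms -/

section LowerNorm

variable {V W : Type*} [NormedAddCommGroup V] [NormedSpace ℂ V]
  [NormedAddCommGroup W] [NormedSpace ℂ W]

theorem lowerNorm_nonneg (B : V →L[ℂ] W) : 0 ≤ lowerNorm B :=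
  Real.sInf_nonneg (forall_mem_image.2 fun _ _ => norm_nonneg _)

theorem lowerNorm_mul_norm_le (B : V →L[ℂ] W) (x : V) : lowerNorm B * ‖x‖ ≤ ‖B x‖ := by
  rcases eq_or_ne x 0 with rfl | hx
  · simp
  have hbdd : BddBelow ((fun x => ‖B x‖) '' {x : V | ‖x‖ = 1}) :=
    ⟨0, forall_mem_image.2 fun _ _ => norm_nonneg _⟩
  have hx' : 0 < ‖x‖ := norm_pos_iff.2 hx
  have h : lowerNorm B ≤ ‖B ((‖x‖⁻¹ : ℂ) • x)‖ :=
    csInf_le hbdd ⟨_, by simp [norm_smul, hx'.ne'], rfl⟩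
  rwa [map_smul, norm_smul, norm_inv, Complex.norm_real, norm_norm, inv_mul_eq_div,
    le_div_iff₀ hx'] at h

theorem le_lowerNorm [Nontrivial V] {B : V →L[ℂ] W} {c : ℝ} (h : ∀ x, c * ‖x‖ ≤ ‖B x‖) :
    c ≤ lowerNorm B := by
  obtain ⟨x, hx⟩ := exists_norm_eq V zero_le_one
  refine le_csInf ⟨_, x, hx, rfl⟩ (forall_mem_image.2 fun y (hy : ‖y‖ = 1) => ?_)
  simpa [hy] using h y

theorem lowerNorm_le_add_norm_sub [Nontrivial V] (B C : V →L[ℂ] W) :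
    lowerNorm B ≤ lowerNorm C + ‖B - C‖ := by
  suffices lowerNorm B - ‖B - C‖ ≤ lowerNorm C by linarith
  refine le_lowerNorm fun x => ?_
  calc (lowerNorm B - ‖B - C‖) * ‖x‖ = lowerNorm B * ‖x‖ - ‖B - C‖ * ‖x‖ := sub_mul _ _ _
    _ ≤ ‖B x‖ - ‖(B - C) x‖ :=
      sub_le_sub (lowerNorm_mul_norm_le B x) ((B - C).le_opNorm x)
    _ ≤ ‖C x‖ := by simpa using norm_sub_norm_le (B x) ((B - C) x)

theorem lowerNorm_congr {V' W' : Type*} [NormedAddCommGroup V'] [NormedSpace ℂ V']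
    [NormedAddCommGroup W'] [NormedSpace ℂ W'] (e : V ≃ₗᵢ[ℂ] V') {B : V →L[ℂ] W}
    {B' : V' →L[ℂ] W'} (h : ∀ x, ‖B' (e x)‖ = ‖B x‖) : lowerNorm B = lowerNorm B' := by
  have hsphere : e '' {x | ‖x‖ = 1} = {y | ‖y‖ = 1} := by
    ext y
    exact ⟨by rintro ⟨x, hx, rfl⟩; simpa using hx, fun hy => ⟨e.symm y, by simpa using hy, by simp⟩⟩
  simp only [lowerNorm, ← hsphere, image_image, h]

theorem lowerNorm_le_lowerNormOn (B : V →L[ℂ] W) (Z : Submodule ℂ V) [Nontrivial Z] :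
    lowerNorm B ≤ lowerNormOn B Z :=
  le_lowerNorm fun x => lowerNorm_mul_norm_le B x

theorem lowerNormOn_mul_norm_le (B : V →L[ℂ] W) (Z : Submodule ℂ V) {x : V} (hx : x ∈ Z) :
    lowerNormOn B Z * ‖x‖ ≤ ‖B x‖ :=
  lowerNorm_mul_norm_le (B ∘L Z.subtypeL) ⟨x, hx⟩

theorem lowerNorm_eq_one_div_norm [Nontrivial V] {B : V →L[ℂ] W} {C : W →L[ℂ] V}
    (hCB : ∀ x, C (B x) = x) (hBC : ∀ y, B (C y) = y) : lowerNorm B = 1 / ‖C‖ := by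
  have hC : 0 < ‖C‖ := by
    obtain ⟨x, hx⟩ := exists_ne (0 : V)
    refine norm_pos_iff.2 fun h => hx ?_
    rw [← hCB x, h, zero_apply]
  have hle : 1 / ‖C‖ ≤ lowerNorm B := by
    refine le_lowerNorm fun x => ?_
    rw [one_div, inv_mul_le_iff₀ hC]
    simpa [hCB] using C.le_opNorm (B x)
  have hpos : 0 < lowerNorm B := (one_div_pos.2 hC).trans_le hle
  refine le_antisymm ((le_one_div hpos hC).2 ?_) hle
  refine C.opNorm_le_bound (one_div_pos.2 hpos).le fun y => ?_
  rw [one_div, le_inv_mul_iff₀ hpos]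
  simpa [hBC] using lowerNorm_mul_norm_le B (C y)

theorem norm_dual (B : V →L[ℂ] W) : ‖dual B‖ = ‖B‖ := by
  refine le_antisymm (ContinuousLinearMap.opNorm_le_bound _ (norm_nonneg _) fun f => ?_)
    (B.opNorm_le_bound (norm_nonneg (dual B)) fun x => ?_)
  · rw [mul_comm]
    exact f.opNorm_comp_le B
  · obtain ⟨g, hg, hgx⟩ := exists_dual_vector'' ℂ (B x)
    calc ‖B x‖ = ‖dual B g x‖ := by simp [dual, hgx]
      _ ≤ ‖dual B g‖ * ‖x‖ := (dual B g).le_opNorm x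
      _ ≤ ‖dual B‖ * ‖x‖ := by
        gcongr
        exact (dual B).unit_le_opNorm g hg

theorem dual_sub (B C : V →L[ℂ] W) : dual (B - C) = dual B - dual C := by
  ext f x
  simp [dual]

end LowerNorm

/-! ### The reciprocal norm of the inverse -/

section RecipNormInv

variable {V : Type*} [NormedAddCommGroup V] [NormedSpace ℂ V]

theorem exists_dual_ne_zero_of_isClosed {p : Submodule ℂ V} (hp : IsClosed (p : Set V))
    (hne : p ≠ ⊤) : ∃ f : StrongDual ℂ V, f ≠ 0 ∧ ∀ x ∈ p, f x = 0 := by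
  obtain ⟨x, hx⟩ := SetLike.exists_not_mem_of_ne_top p hne rfl
  have hx' : p.mkQL x ≠ 0 := by simpa using hx
  obtain ⟨g, hg⟩ := SeparatingDual.exists_ne_zero (R := ℂ) hx'
  refine ⟨g ∘L p.mkQL, fun h => hg congr($h x), fun y hy => ?_⟩
  have hy' : p.mkQL y = 0 := by simpa using hy
  rw [ContinuousLinearMap.comp_apply, hy', map_zero]

theorem isUnit_of_lowerNorm_pos [CompleteSpace V] {B : V →L[ℂ] V} (h : 0 < lowerNorm B)
    (h' : 0 < lowerNorm (dual B)) : IsUnit B := by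
  have hanti : AntilipschitzWith (lowerNorm B)⁻¹.toNNReal B :=
    AddMonoidHomClass.antilipschitz_of_bound B fun x => by
      rw [Real.coe_toNNReal _ (inv_nonneg.2 h.le), le_inv_mul_iff₀ h]
      exact lowerNorm_mul_norm_le B x
  rw [ContinuousLinearMap.isUnit_iff_bijective,
    ContinuousLinearMap.bijective_iff_dense_range_and_antilipschitz]
  refine ⟨by_contra fun hdense => ?_, _, hanti⟩
  obtain ⟨f, hf, hfB⟩ := exists_dual_ne_zero_of_isClosed
    (Submodule.isClosed_topologicalClosure _) hdense
  have hBf : dual B f = 0 := by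
    ext x
    exact hfB _ (Submodule.le_topologicalClosure _ ⟨x, rfl⟩)
  have hle := lowerNorm_mul_norm_le (dual B) f
  rw [hBf, norm_zero] at hle
  exact hle.not_gt (mul_pos h' (norm_pos_iff.2 hf))

theorem recipNormInv_units (u : (V →L[ℂ] V)ˣ) :
    recipNormInv (u : V →L[ℂ] V) = 1 / ‖(↑u⁻¹ : V →L[ℂ] V)‖ := by
  rw [recipNormInv, if_pos u.isUnit, Ring.inverse_unit]

theorem recipNormInv_eq_min [CompleteSpace V] [Nontrivial V] (B : V →L[ℂ] V) :
    recipNormInv B = min (lowerNorm B) (lowerNorm (dual B)) := by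
  by_cases hB : IsUnit B
  · obtain ⟨u, rfl⟩ := hB
    have hl (x : V) : (↑u⁻¹ : V →L[ℂ] V) ((u : V →L[ℂ] V) x) = x := congr($u.inv_mul x)
    have hr (x : V) : (u : V →L[ℂ] V) ((↑u⁻¹ : V →L[ℂ] V) x) = x := congr($u.mul_inv x)
    have hdual : lowerNorm (dual (u : V →L[ℂ] V)) = 1 / ‖dual (↑u⁻¹ : V →L[ℂ] V)‖ :=
      lowerNorm_eq_one_div_norm (fun f => by ext x; simp [dual, hr])
        fun f => by ext x; simp [dual, hl]
    rw [recipNormInv_units, hdual, norm_dual, lowerNorm_eq_one_div_norm hl hr, min_self]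
  · rw [recipNormInv, if_neg hB]
    refine le_antisymm (le_min (lowerNorm_nonneg _) (lowerNorm_nonneg _)) ?_
    by_contra! hpos
    exact hB (isUnit_of_lowerNorm_pos (lt_min_iff.1 hpos).1 (lt_min_iff.1 hpos).2)

theorem recipNormInv_le_add_norm_sub [CompleteSpace V] [Nontrivial V] (B C : V →L[ℂ] V) :
    recipNormInv B ≤ recipNormInv C + ‖B - C‖ := by
  have hdual := lowerNorm_le_add_norm_sub (dual B) (dual C)
  rw [← dual_sub, norm_dual] at hdual
  rw [recipNormInv_eq_min, recipNormInv_eq_min, ← min_add_add_right]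
  exact min_le_min (lowerNorm_le_add_norm_sub B C) hdual

theorem recipNormInv_conj {W : Type*} [NormedAddCommGroup W] [NormedSpace ℂ W]
    (e : V ≃ₗᵢ[ℂ] W) (B : V →L[ℂ] V) :
    recipNormInv (e.toContinuousLinearEquiv.conjContinuousAlgEquiv B) = recipNormInv B := by
  set φ := e.toContinuousLinearEquiv.conjContinuousAlgEquiv
  have hnorm (C : V →L[ℂ] V) : ‖φ C‖ = ‖C‖ :=
    (ContinuousLinearMap.opNorm_linearIsometryEquiv_comp e _).trans
      (C.opNorm_comp_linearIsometryEquiv e.symm)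
  by_cases hB : IsUnit B
  · obtain ⟨u, rfl⟩ := hB
    rw [recipNormInv_units, ← hnorm]
    exact recipNormInv_units (Units.map (φ : (V →L[ℂ] V) →* (W →L[ℂ] W)) u)
  · rw [recipNormInv, recipNormInv, if_neg hB, if_neg (by rwa [MulEquiv.isUnit_map])]

end RecipNormInv

/-! ### Coordinates and matrix entries -/

section Matrix

variable {Y : Type*} [NormedAddCommGroup Y] [NormedSpace ℂ Y]

theorem coord_apply (j : ℤ) (x : Ell Y) : coord j x = x j := rfl

theorem embed_apply (j : ℤ) (y : Y) (i : ℤ) : embed j y i = if i = j then y else 0 := by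
  change lp.single (E := fun _ : ℤ => Y) 2 j y i = _
  rw [lp.single_apply, Pi.single_apply]

theorem norm_embed (j : ℤ) (y : Y) : ‖embed j y‖ = ‖y‖ :=
  lp.norm_single (E := fun _ : ℤ => Y) two_pos j y

theorem hasSum_embed (x : Ell Y) : HasSum (fun j => embed j (x j)) x :=
  lp.hasSum_single ENNReal.ofNat_ne_top x

theorem hasSum_norm_sq {Z : Type*} [NormedAddCommGroup Z] (x : Ell Z) :
    HasSum (fun j => ‖x j‖ ^ 2) (‖x‖ ^ 2) := by
  rw [norm_sq_eq_tsum]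
  exact ((memℓp_iff_sq fun i => x i).1 (lp.memℓp x)).hasSum

theorem norm_sum_embed_sq (s : Finset ℤ) (f : ℤ → Y) :
    ‖∑ j ∈ s, embed j (f j)‖ ^ 2 = ∑ j ∈ s, ‖f j‖ ^ 2 := by
  simpa using! lp.norm_sum_single (E := fun _ : ℤ => Y) (p := 2) (by simp) f s

theorem entry_apply (B : Op Y) (i j : ℤ) (y : Y) : entry B i j y = B (embed j y) i := rfl

theorem hasSum_entry (B : Op Y) (x : Ell Y) (i : ℤ) :
    HasSum (fun j => entry B i j (x j)) (B x i) :=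
  ((hasSum_embed x).mapL B).mapL (coord i)

theorem ext_entry {B C : Op Y} (h : ∀ i j, entry B i j = entry C i j) : B = C := by
  ext x i
  refine (hasSum_entry B x i).unique ?_
  simpa only [h] using hasSum_entry C x i

theorem norm_entry_le (B : Op Y) (i j : ℤ) : ‖entry B i j‖ ≤ ‖B‖ := by
  refine ContinuousLinearMap.opNorm_le_bound _ (norm_nonneg B) fun y => ?_
  calc ‖entry B i j y‖ ≤ ‖B (embed j y)‖ := lp.norm_apply_le_norm two_ne_zero _ i
    _ ≤ ‖B‖ * ‖y‖ := by simpa only [norm_embed] using B.le_opNorm (embed j y)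

theorem entry_subScalar (B : Op Y) (z : ℂ) (i j : ℤ) :
    entry (subScalar B z) i j =
      entry B i j - if i = j then z • ContinuousLinearMap.id ℂ Y else 0 := by
  ext y
  change B (embed j y) i - z • embed j y i = _
  rw [embed_apply]
  split_ifs <;> simp [entry_apply]

theorem HasBandwidth.subScalar {B : Op Y} {w : ℕ} (h : HasBandwidth B w) (z : ℂ) :
    HasBandwidth (subScalar B z) w := fun i j hij => by
  have hne : i ≠ j := by
    rintro rfl
    rw [sub_self, abs_zero] at hij
    omega
  rw [entry_subScalar, h i j hij, if_neg hne, sub_zero]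

theorem proj_apply (n : ℕ) (k : ℤ) (x : Ell Y) (i : ℤ) :
    proj n k x i = if i ∈ Finset.Icc (k + 1) (k + n) then x i else 0 := by
  rw [← coord_apply, proj, sum_apply, map_sum]
  simp [coord_apply, embed_apply]

theorem mem_sectionSpace {n : ℕ} {k : ℤ} {x : Ell Y} :
    x ∈ sectionSpace Y n k ↔ ∀ i ∉ Finset.Icc (k + 1) (k + n), x i = 0 := by
  refine ⟨?_, fun h => ⟨x, ?_⟩⟩
  · rintro ⟨y, rfl⟩ i hi
    exact (proj_apply n k y i).trans (if_neg hi)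
  · ext i
    refine (proj_apply n k x i).trans (ite_eq_left_iff.2 fun hi => ?_)
    rw [h i hi]

theorem entry_proj (n : ℕ) (k i j : ℤ) :
    entry (proj n k : Op Y) i j =
      if i = j ∧ i ∈ Finset.Icc (k + 1) (k + n) then ContinuousLinearMap.id ℂ Y else 0 := by
  ext y
  rw [entry_apply, proj_apply, embed_apply]
  rcases eq_or_ne i j with rfl | hij
  · simp only [true_and, if_true]
    split_ifs <;> rfl
  · simp [hij]

end Matrix

/-! ### The dual of `ℓ²(ℤ, Y)` -/

section Duality

variable {Y : Type*} [NormedAddCommGroup Y] [NormedSpace ℂ Y]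

theorem exists_apply_eq_mul_norm_sq (g : StrongDual ℂ Y) {t : ℝ} (ht0 : 0 ≤ t) (ht : t < 1) :
    ∃ y, ‖y‖ ≤ ‖g‖ ∧ g y = ((t * ‖g‖ ^ 2 : ℝ) : ℂ) := by
  rcases (norm_nonneg g).eq_or_lt with h0 | h0
  · exact ⟨0, by simp, by simp [← h0]⟩
  obtain ⟨x, hx, hgx⟩ := g.exists_lt_apply_of_lt_opNorm (mul_lt_of_lt_one_left h0 ht)
  have hpos : 0 < ‖g x‖ := (by positivity : 0 ≤ t * ‖g‖).trans_lt hgx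
  refine ⟨(((t * ‖g‖ ^ 2 : ℝ) : ℂ) / g x) • x, ?_, ?_⟩
  · have hscale : t * ‖g‖ ^ 2 / ‖g x‖ ≤ ‖g‖ := by
      rw [div_le_iff₀ hpos]
      nlinarith
    rw [norm_smul, norm_div, Complex.norm_real, Real.norm_of_nonneg (by positivity)]
    exact (mul_le_mul hscale hx.le (norm_nonneg _) h0.le).trans_eq (mul_one _)
  · rw [map_smul, smul_eq_mul, div_mul_cancel₀ _ (norm_pos_iff.1 hpos)]

theorem sum_norm_comp_embed_sq_le (f : StrongDual ℂ (Ell Y)) (s : Finset ℤ) :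
    ∑ j ∈ s, ‖f ∘L embed j‖ ^ 2 ≤ ‖f‖ ^ 2 := by
  set N := √(∑ j ∈ s, ‖f ∘L embed j‖ ^ 2)
  have hN : N ^ 2 = ∑ j ∈ s, ‖f ∘L embed j‖ ^ 2 := Real.sq_sqrt (by positivity)
  have hN0 : 0 ≤ N := Real.sqrt_nonneg _
  have almost {t : ℝ} (ht0 : 0 ≤ t) (ht : t < 1) : t * N ^ 2 ≤ ‖f‖ * N := by
    choose y hy hfy using fun j => exists_apply_eq_mul_norm_sq (f ∘L embed j) ht0 ht
    have hnorm : ‖∑ j ∈ s, embed j (y j)‖ ≤ N := by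
      rw [← sq_le_sq₀ (norm_nonneg _) hN0, norm_sum_embed_sq, hN]
      gcongr with j
      exact hy j
    have hval : f (∑ j ∈ s, embed j (y j)) = ((t * N ^ 2 : ℝ) : ℂ) := by
      rw [map_sum, hN, Finset.mul_sum, Complex.ofReal_sum]
      exact Finset.sum_congr rfl fun j _ => hfy j
    calc t * N ^ 2 = ‖f (∑ j ∈ s, embed j (y j))‖ := by
          rw [hval, Complex.norm_real, Real.norm_of_nonneg (by positivity)]
      _ ≤ ‖f‖ * N := f.le_opNorm_of_le hnorm
  have hsq : 1 * N ^ 2 ≤ ‖f‖ * N :=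
    mul_le_of_forall_lt_of_nonneg zero_le_one (by positivity) fun t ht0 ht b _ hb =>
      (mul_le_mul_of_nonneg_left hb.le ht0).trans (almost ht0 ht)
  rw [← hN]
  nlinarith [sq_nonneg (‖f‖ - N)]

/-- The canonical pairing `ℓ²(ℤ, Y*) → ℓ²(ℤ, Y)*`. -/
def pairing (Y : Type*) [NormedAddCommGroup Y] [NormedSpace ℂ Y] :
    Ell (StrongDual ℂ Y) →L[ℂ] StrongDual ℂ (Ell Y) :=
  lp.dualPairing 2 2 (fun _ : ℤ => ContinuousLinearMap.id ℂ (StrongDual ℂ Y)) (K := 1)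
    fun _ => ContinuousLinearMap.norm_id_le

theorem pairing_apply (g : Ell (StrongDual ℂ Y)) (x : Ell Y) :
    pairing Y g x = ∑' j, g j (x j) :=
  lp.dualPairing_apply _ _ g x

theorem pairing_embed (g : Ell (StrongDual ℂ Y)) (j : ℤ) (y : Y) :
    pairing Y g (embed j y) = g j y := by
  rw [pairing_apply, tsum_eq_single j fun i hi => by simp [embed_apply, hi]]
  simp [embed_apply]

theorem embed_pairing (j : ℤ) (f : StrongDual ℂ Y) (x : Ell Y) :
    pairing Y (embed j f) x = f (x j) := by
  rw [pairing_apply, tsum_eq_single j fun i hi => by simp [embed_apply, hi]]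
  simp [embed_apply]

theorem norm_pairing (g : Ell (StrongDual ℂ Y)) : ‖pairing Y g‖ = ‖g‖ := by
  apply le_antisymm
  · have h : ‖pairing Y‖ ≤ 1 := lp.norm_dualPairing _ _
    simpa using (pairing Y).le_of_opNorm_le h g
  · rw [← sq_le_sq₀ (norm_nonneg _) (norm_nonneg _)]
    refine hasSum_le_of_sum_le (hasSum_norm_sq g) fun s => ?_
    have hcomp (j : ℤ) : pairing Y g ∘L embed j = g j := by
      ext y
      exact pairing_embed g j y
    simpa only [hcomp] using sum_norm_comp_embed_sq_le (pairing Y g) s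

theorem memℓp_comp_embed (f : StrongDual ℂ (Ell Y)) :
    Memℓp (fun j : ℤ => f ∘L (embed j : Y →L[ℂ] Ell Y)) 2 := by
  rw [memℓp_iff_sq]
  exact summable_of_sum_le (fun _ => by positivity) (sum_norm_comp_embed_sq_le f)

/-- The isometric isomorphism `ℓ²(ℤ, Y*) ≃ ℓ²(ℤ, Y)*`. -/
def dualIso (Y : Type*) [NormedAddCommGroup Y] [NormedSpace ℂ Y] :
    Ell (StrongDual ℂ Y) ≃ₗᵢ[ℂ] StrongDual ℂ (Ell Y) where
  toFun g := pairing Y g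
  map_add' := map_add _
  map_smul' := map_smul _
  invFun f := ⟨fun j => f ∘L embed j, memℓp_comp_embed f⟩
  left_inv g := by
    ext j y
    exact pairing_embed g j y
  right_inv f := by
    ext x
    refine ((hasSum_embed x).mapL _).unique ?_
    convert! (hasSum_embed x).mapL f using 2 with j
    exact pairing_embed _ j (x j)
  norm_map' := norm_pairing

/-- The adjoint `B*`, transported to an operator on `ℓ²(ℤ, Y*)`. -/
def transpose (B : Op Y) : Op (StrongDual ℂ Y) :=
  (dualIso Y).symm.toContinuousLinearEquiv.conjContinuousAlgEquiv (dual B)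

theorem dualIso_transpose (B : Op Y) (g : Ell (StrongDual ℂ Y)) :
    dualIso Y (transpose B g) = dual B (dualIso Y g) :=
  (dualIso Y).apply_symm_apply _

theorem entry_transpose (B : Op Y) (i j : ℤ) :
    entry (transpose B) i j = dual (entry B j i) := by
  ext f y
  exact embed_pairing j f (B (embed i y))

theorem HasBandwidth.transpose {B : Op Y} {w : ℕ} (h : HasBandwidth B w) :
    HasBandwidth (transpose B) w := fun i j hij => by
  rw [entry_transpose, h j i (by rwa [abs_sub_comm])]
  ext f _
  exact map_zero f

theorem conj_subScalar {V W : Type*} [NormedAddCommGroup V] [NormedSpace ℂ V]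
    [NormedAddCommGroup W] [NormedSpace ℂ W] (e : V ≃L[ℂ] W) (B : V →L[ℂ] V) (z : ℂ) :
    e.conjContinuousAlgEquiv (subScalar B z) = subScalar (e.conjContinuousAlgEquiv B) z := by
  ext x
  simp [subScalar]

theorem dual_subScalar {V : Type*} [NormedAddCommGroup V] [NormedSpace ℂ V] (B : V →L[ℂ] V)
    (z : ℂ) : dual (subScalar B z) = subScalar (dual B) z := by
  ext f x
  simp [dual, subScalar]

theorem transpose_subScalar (B : Op Y) (z : ℂ) :
    transpose (subScalar B z) = subScalar (transpose B) z := by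
  rw [transpose, dual_subScalar, conj_subScalar, transpose]

theorem lowerNorm_transpose (B : Op Y) : lowerNorm (transpose B) = lowerNorm (dual B) :=
  lowerNorm_congr (dualIso Y) fun g => by
    rw [← dualIso_transpose, (dualIso Y).norm_map]

theorem transpose_proj (n : ℕ) (k : ℤ) : transpose (proj n k : Op Y) = proj n k :=
  ext_entry fun i j => by
    have hiff : (j = i ∧ j ∈ Finset.Icc (k + 1) (k + n)) ↔
        i = j ∧ i ∈ Finset.Icc (k + 1) (k + n) := by grind
    rw [entry_transpose, entry_proj, entry_proj, if_congr hiff rfl rfl]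
    split_ifs <;> · ext f y; simp [dual]

theorem dualSectionSpace_eq_map (n : ℕ) (k : ℤ) :
    dualSectionSpace Y n k =
      (sectionSpace (StrongDual ℂ Y) n k).map (dualIso Y).toLinearEquiv.toLinearMap := by
  have hcomp : (dual (proj n k : Op Y)).toLinearMap ∘ₗ (dualIso Y).toLinearEquiv.toLinearMap =
      (dualIso Y).toLinearEquiv.toLinearMap ∘ₗ (proj n k).toLinearMap := by
    ext1 g
    exact (dualIso_transpose _ g).symm.trans (by rw [transpose_proj]; rfl)
  rw [sectionSpace, ← LinearMap.range_comp, ← hcomp, LinearEquiv.range_comp, dualSectionSpace]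

theorem lowerNormOn_dual (B : Op Y) (n : ℕ) (k : ℤ) :
    lowerNormOn (dual B) (dualSectionSpace Y n k) =
      lowerNormOn (transpose B) (sectionSpace (StrongDual ℂ Y) n k) := by
  rw [dualSectionSpace_eq_map]
  refine (lowerNorm_congr ((dualIso Y).submoduleMap _) fun g => ?_).symm
  exact (congrArg norm (dualIso_transpose B g).symm).trans ((dualIso Y).norm_map _)

end Duality

/-! ### One-sided truncations -/

section Truncation

variable {Y : Type*} [NormedAddCommGroup Y] [NormedSpace ℂ Y]

/-- The embedding of `{0, …, m - 1}` into `ℤ` that starts at `k`; it numbers the rows and columns of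
finite submatrices. -/
def window (m : ℕ) (k : ℤ) (c : Fin m) : ℤ := k + (c : ℕ)

theorem window_injective (m : ℕ) (k : ℤ) : Function.Injective (window m k) := fun a b h => by
  simp only [window] at h
  omega

theorem mem_range_window {m : ℕ} {k i : ℤ} : i ∈ range (window m k) ↔ k ≤ i ∧ i < k + m := by
  constructor
  · rintro ⟨c, rfl⟩
    simp only [window]
    omega
  · rintro ⟨h1, h2⟩
    exact ⟨⟨(i - k).toNat, by omega⟩, by simp only [window]; omega⟩

theorem hasSum_eq_sum_window {M : Type*} [AddCommMonoid M] [TopologicalSpace M] [T2Space M]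
    {f : ℤ → M} {a : M} (hf : HasSum f a) {m : ℕ} {k : ℤ} (h : ∀ i ∉ range (window m k), f i = 0) :
    a = ∑ c, f (window m k c) :=
  (((window_injective m k).hasSum_iff h).2 hf).unique (hasSum_fintype _)

theorem mem_sectionSpace_iff_window {n : ℕ} {k : ℤ} {x : Ell Y} :
    x ∈ sectionSpace Y n k ↔ ∀ i ∉ range (window n (k + 1)), x i = 0 := by
  rw [mem_sectionSpace]
  refine forall_congr' fun i => ?_
  rw [mem_range_window, Finset.mem_Icc, show i ≤ k + n ↔ i < k + 1 + n by omega]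

theorem sum_embed_window_apply {n : ℕ} {k : ℤ} (ξ : Fin n → Y) (i : ℤ) :
    (∑ c, embed (window n k c) (ξ c)) i = ∑ c, if i = window n k c then ξ c else 0 := by
  rw [← coord_apply, map_sum]
  simp only [coord_apply, embed_apply]

/-- The isometric isomorphism `E_{n,k} ≃ Yⁿ`. -/
def sectionIso (Y : Type*) [NormedAddCommGroup Y] [NormedSpace ℂ Y] (n : ℕ) (k : ℤ) :
    sectionSpace Y n k ≃ₗᵢ[ℂ] Pow Y n :=
  LinearIsometryEquiv.ofSurjective
    { toFun := fun x => WithLp.toLp 2 fun c => (x : Ell Y) (window n (k + 1) c)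
      map_add' := fun _ _ => rfl
      map_smul' := fun _ _ => rfl
      norm_map' := fun x => by
        refine (sq_eq_sq₀ (norm_nonneg _) (norm_nonneg _)).1 ((block_norm_sq _).trans ?_)
        refine (hasSum_eq_sum_window (hasSum_norm_sq (x : Ell Y)) fun i hi => ?_).symm
        rw [mem_sectionSpace_iff_window.1 x.2 i hi, norm_zero, zero_pow two_ne_zero] }
    (fun ξ => ⟨⟨∑ c, embed (window n (k + 1) c) (ξ c), mem_sectionSpace_iff_window.2
        fun i hi => by
          rw [sum_embed_window_apply]
          exact Finset.sum_eq_zero fun c _ => if_neg fun h => hi ⟨c, h.symm⟩⟩, by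
      ext c
      refine (sum_embed_window_apply ξ _).trans ?_
      simp [(window_injective n (k + 1)).eq_iff]⟩)

theorem ofEntries_apply {m n : ℕ} (M : Fin m → Fin n → (Y →L[ℂ] Y)) (ξ : Pow Y n) (r : Fin m) :
    ofEntries M ξ r = ∑ c, M r c (ξ c) := by
  change (∑ c, M r c ∘L PiLp.proj (𝕜 := ℂ) 2 (fun _ : Fin n => Y) c) ξ = _
  simp

theorem truncPlus_sectionIso_apply (B : Op Y) {n : ℕ} {k : ℤ} (x : sectionSpace Y n k)
    (r : Fin (n + 2)) : truncPlus n k B (sectionIso Y n k x) r = B x (k + (r : ℕ)) := by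
  refine (ofEntries_apply _ _ r).trans ?_
  refine (hasSum_eq_sum_window (hasSum_entry B x _) fun i hi => ?_).symm
  rw [mem_sectionSpace_iff_window.1 x.2 i hi, map_zero]

theorem lowerNormOn_sectionSpace {B : Op Y} (hB : IsTridiagonal B) (n : ℕ) (k : ℤ) :
    lowerNormOn B (sectionSpace Y n k) = lowerNorm (truncPlus n k B) := by
  refine lowerNorm_congr (sectionIso Y n k) fun x => ?_
  have hsupp (i : ℤ) (hi : i ∉ range (window (n + 2) k)) : B x i = 0 := by
    refine (hasSum_entry B x i).unique (hasSum_zero.congr_fun fun j => ?_)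
    by_cases hj : j ∈ range (window n (k + 1))
    · rw [mem_range_window] at hi hj
      rw [hB i j (lt_abs.2 (by push_cast at hi ⊢; omega)), zero_apply]
    · rw [mem_sectionSpace_iff_window.1 x.2 j hj, map_zero]
  refine (sq_eq_sq₀ (norm_nonneg _) (norm_nonneg _)).1 ?_
  rw [PiLp.norm_sq_eq_of_L2]
  simp only [truncPlus_sectionIso_apply]
  refine (hasSum_eq_sum_window (hasSum_norm_sq (B x)) fun i hi => ?_).symm
  rw [hsupp i hi, norm_zero, zero_pow two_ne_zero]

theorem truncPlus_subScalar (B : Op Y) (n : ℕ) (k : ℤ) (z : ℂ) :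
    truncPlus n k (subScalar B z) = truncPlus n k B - z • idPlus Y n := by
  ext ξ r
  rw [sub_apply, smul_apply, PiLp.sub_apply, PiLp.smul_apply, truncPlus, truncPlus, idPlus,
    ofEntries_apply, ofEntries_apply, ofEntries_apply, Finset.smul_sum, ← Finset.sum_sub_distrib]
  refine Finset.sum_congr rfl fun c _ => ?_
  have hiff : k + (r : ℕ) = k + 1 + (c : ℕ) ↔ (r : ℕ) = c + 1 := by omega
  rw [entry_subScalar, if_congr hiff rfl rfl]
  split_ifs <;> simp

theorem truncPlusDual_eq (n : ℕ) (k : ℤ) (B : Op Y) :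
    truncPlusDual n k B = truncPlus n k (transpose B) := by
  simp only [truncPlusDual, truncPlus, entry_transpose]

theorem muFin_subScalar {B : Op Y} (hB : IsTridiagonal B) (n : ℕ) (K : Finset ℤ) (z : ℂ) :
    muFin n K (subScalar B z) = muFinMat n K B z := by
  simp only [muFin, muFinMat, lowerNormOn_dual, lowerNormOn_sectionSpace (hB.subScalar z),
    lowerNormOn_sectionSpace (hB.transpose.subScalar z), transpose_subScalar, truncPlus_subScalar,
    truncPlusDual_eq]

end Truncation

/-! ### Localization of a tridiagonal operator -/

section Shift

variable {Z : Type*} [NormedAddCommGroup Z]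

/-- The translation `(x_i) ↦ (x_{i+d})` of `ℓ²(ℤ, Z)`. -/
def shift (d : ℤ) (x : Ell Z) : Ell Z :=
  ⟨fun i => x (i + d), (memℓp_iff_sq _).2
    ((Equiv.addRight d).summable_iff.2 (hasSum_norm_sq x).summable)⟩

theorem shift_apply (d : ℤ) (x : Ell Z) (i : ℤ) : shift d x i = x (i + d) := rfl

theorem norm_shift (d : ℤ) (x : Ell Z) : ‖shift d x‖ = ‖x‖ := by
  rw [← sq_eq_sq₀ (norm_nonneg _) (norm_nonneg _)]
  exact (hasSum_norm_sq (shift d x)).unique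
    ((Equiv.addRight d).hasSum_iff.2 (hasSum_norm_sq x))

theorem norm_shift_neg_sub (d : ℤ) (x : Ell Z) : ‖shift (-d) x - x‖ = ‖shift d x - x‖ := by
  have h : shift (-d) x - x = -shift (-d) (shift d x - x) := by
    ext i
    change x (i + -d) - x i = -(x (i + -d + d) - x (i + -d))
    rw [neg_add_cancel_right, neg_sub]
  rw [h, norm_neg, norm_shift]

end Shift

section Localize

variable {Y : Type*} [NormedAddCommGroup Y] [NormedSpace ℂ Y]

theorem hasSum_norm_sq_translate_smul (p : Ell ℝ) (x : Ell Y) :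
    HasSum (fun q : ℤ × ℤ => ‖(p (q.2 - q.1) : ℂ) • x q.2‖ ^ 2) ((‖p‖ * ‖x‖) ^ 2) := by
  let e : ℤ × ℤ ≃ ℤ × ℤ :=
    { toFun := fun q => (q.2 - q.1, q.2)
      invFun := fun q => (q.2 - q.1, q.2)
      left_inv := fun q => by simp
      right_inv := fun q => by simp }
  have hp := hasSum_norm_sq p
  have hx := hasSum_norm_sq x
  have hpx := hp.mul hx (hp.summable.mul_of_nonneg hx.summable
    (fun _ => sq_nonneg _) fun _ => sq_nonneg _)
  simpa only [mul_pow, norm_smul, Complex.norm_real, Function.comp_def] using! e.hasSum_iff.2 hpx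

/-- The family, indexed by `k`, of the sequences `x` weighted by the translate of `p` to `k`. -/
def localize (p : Ell ℝ) (x : Ell Y) : Ell (Ell Y) :=
  have hs := (hasSum_norm_sq_translate_smul p x).summable
  ⟨fun k => ⟨fun i => (p (i - k) : ℂ) • x i, (memℓp_iff_sq _).2 (hs.prod_factor k)⟩,
    (memℓp_iff_sq _).2 (by simpa only [norm_sq_eq_tsum] using hs.prod)⟩

theorem localize_apply (p : Ell ℝ) (x : Ell Y) (k i : ℤ) :
    localize p x k i = (p (i - k) : ℂ) • x i := rfl

theorem norm_localize (p : Ell ℝ) (x : Ell Y) : ‖localize p x‖ = ‖p‖ * ‖x‖ := by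
  rw [← sq_eq_sq₀ (norm_nonneg _) (by positivity)]
  exact (hasSum_norm_sq (localize p x)).unique
    ((hasSum_norm_sq_translate_smul p x).prod_fiberwise fun k => hasSum_norm_sq (localize p x k))

theorem localize_mem_sectionSpace {p : Ell ℝ} {n : ℕ} (hp : ∀ m ∉ Finset.Icc 1 (n : ℤ), p m = 0)
    (x : Ell Y) (k : ℤ) : localize p x k ∈ sectionSpace Y n k :=
  mem_sectionSpace.2 fun i hi => by
    rw [localize_apply, hp (i - k) (by grind), Complex.ofReal_zero, zero_smul]

theorem bddAbove_norm_entry (B : Op Y) (d : ℤ) :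
    BddAbove (range fun i => ‖entry B i (i + d)‖) :=
  ⟨‖B‖, by rintro _ ⟨i, rfl⟩; exact norm_entry_le _ _ _⟩

/-- The `d`-th diagonal of the matrix of `B`, as the operator `x ↦ (b_{i,i+d} x_i)_i`. -/
def diagonal (B : Op Y) (d : ℤ) : Op Y :=
  lp.mapCLM 2 (fun i => entry B i (i + d)) (Real.iSup_nonneg fun _ => norm_nonneg _)
    (le_ciSup (bddAbove_norm_entry B d))

theorem norm_diagonal_le (B : Op Y) (d : ℤ) : ‖diagonal B d‖ ≤ ⨆ i, ‖entry B i (i + d)‖ :=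
  lp.norm_mapCLM_le ..

theorem IsTridiagonal.apply {B : Op Y} (hB : IsTridiagonal B) (x : Ell Y) (i : ℤ) :
    B x i = entry B i i (x i) + diagonal B 1 (shift 1 x) i + diagonal B (-1) (shift (-1) x) i := by
  have h := hasSum_sum_of_ne_finset_zero (s := {i, i + 1, i + -1})
    (f := fun j => entry B i j (x j)) (L := .unconditional ℤ) fun j hj => by
      rw [hB i j (by grind), zero_apply]
  rw [(hasSum_entry B x i).unique h, Finset.sum_insert (by grind), Finset.sum_insert (by grind),
    Finset.sum_singleton, add_assoc]
  rfl

theorem IsTridiagonal.apply_localize {B : Op Y} (hB : IsTridiagonal B) (p : Ell ℝ) (x : Ell Y)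
    (k : ℤ) :
    B (localize p x k) = (localize p (B x) + localize (shift 1 p - p) (diagonal B 1 (shift 1 x)) +
      localize (shift (-1) p - p) (diagonal B (-1) (shift (-1) x))) k := by
  have hdiag (d i : ℤ) : diagonal B d (shift d (localize p x k)) i =
      (p (i - k + d) : ℂ) • diagonal B d (shift d x) i := by
    rw [← add_sub_right_comm]
    exact (entry B i (i + d)).map_smul _ _
  ext i
  have hcommutator (d : ℤ) : localize (shift d p - p) (diagonal B d (shift d x)) k i =
      (p (i - k + d) : ℂ) • diagonal B d (shift d x) i -
        (p (i - k) : ℂ) • diagonal B d (shift d x) i := by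
    rw [← sub_smul, ← Complex.ofReal_sub]
    rfl
  rw [hB.apply, hdiag, hdiag, localize_apply, map_smul]
  change _ = localize p (B x) k i + localize (shift 1 p - p) (diagonal B 1 (shift 1 x)) k i +
    localize (shift (-1) p - p) (diagonal B (-1) (shift (-1) x)) k i
  rw [hcommutator, hcommutator, localize_apply, hB.apply]
  module

theorem norm_localize_diagonal_le (B : Op Y) (d : ℤ) (p : Ell ℝ) (x : Ell Y) :
    ‖localize p (diagonal B d (shift d x))‖ ≤ ‖p‖ * ((⨆ i, ‖entry B i (i + d)‖) * ‖x‖) := by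
  rw [norm_localize, ← norm_shift d x]
  gcongr
  exact (diagonal B d).le_of_opNorm_le (norm_diagonal_le B d) _

/-- Discrete IMS localization: the commutators of `B` with the translates of `p` only involve the
increments of `p`. -/
theorem IsTridiagonal.mul_norm_le {B : Op Y} (hB : IsTridiagonal B) {n : ℕ} {c : ℝ} (hc0 : 0 ≤ c)
    (hc : ∀ k, c ≤ lowerNormOn B (sectionSpace Y n k)) {p : Ell ℝ}
    (hp : ∀ m ∉ Finset.Icc 1 (n : ℤ), p m = 0) (x : Ell Y) :
    c * (‖p‖ * ‖x‖) ≤ ‖p‖ * ‖B x‖ + ‖shift 1 p - p‖ * (offDiag B * ‖x‖) := by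
  set R := localize p (B x) + localize (shift 1 p - p) (diagonal B 1 (shift 1 x)) +
      localize (shift (-1) p - p) (diagonal B (-1) (shift (-1) x)) with hR
  have hlocal (k : ℤ) : ‖((c : ℂ) • localize p x) k‖ ≤ ‖R k‖ := by
    rw [hR, ← hB.apply_localize, lp.coeFn_smul, Pi.smul_apply, norm_smul, Complex.norm_real,
      Real.norm_of_nonneg hc0]
    exact (mul_le_mul_of_nonneg_right (hc k) (norm_nonneg _)).trans
      (lowerNormOn_mul_norm_le B _ (localize_mem_sectionSpace hp x k))
  calc c * (‖p‖ * ‖x‖) = ‖(c : ℂ) • localize p x‖ := by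
        rw [norm_smul, Complex.norm_real, Real.norm_of_nonneg hc0, norm_localize]
    _ ≤ ‖R‖ := lp.norm_mono two_ne_zero hlocal
    _ ≤ _ := norm_add₃_le
    _ ≤ ‖p‖ * ‖B x‖ + ‖shift 1 p - p‖ * ((⨆ i, ‖entry B i (i + 1)‖) * ‖x‖) +
          ‖shift (-1) p - p‖ * ((⨆ i, ‖entry B i (i + -1)‖) * ‖x‖) := by
        gcongr
        · exact (norm_localize _ _).le
        · exact norm_localize_diagonal_le ..
        · exact norm_localize_diagonal_le ..
    _ = ‖p‖ * ‖B x‖ + ‖shift 1 p - p‖ * (offDiag B * ‖x‖) := by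
        rw [norm_shift_neg_sub, offDiag]
        simp only [sub_eq_add_neg]
        ring

end Localize

/-! ### Sine weights -/

section SineWeight

open Real

theorem memℓp_sineWeight (n : ℕ) :
    Memℓp (fun m : ℤ => if m ∈ Finset.Icc 1 (n : ℤ) then sin (m * (π / (n + 1))) else 0) 2 := by
  refine (memℓp_iff_sq _).2 (summable_of_ne_finset_zero (s := Finset.Icc 1 (n : ℤ)) fun m hm => ?_)
  rw [if_neg hm, norm_zero, zero_pow two_ne_zero]

/-- The sequence with the entries `sin (m π / (n + 1))`, `m = 1, …, n`. -/
def sineWeight (n : ℕ) : Ell ℝ :=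
  ⟨fun m => if m ∈ Finset.Icc 1 (n : ℤ) then sin (m * (π / (n + 1))) else 0, memℓp_sineWeight n⟩

theorem sineWeight_eq_zero {n : ℕ} : ∀ m ∉ Finset.Icc 1 (n : ℤ), sineWeight n m = 0 :=
  fun _ hm => if_neg hm

theorem sineWeight_eq_sin {n : ℕ} {m : ℤ} (h0 : 0 ≤ m) (h1 : m ≤ n + 1) :
    sineWeight n m = sin (m * (π / (n + 1))) := by
  by_cases h : m ∈ Finset.Icc 1 (n : ℤ)
  · exact if_pos h
  rw [sineWeight_eq_zero m h]
  obtain rfl | rfl : m = 0 ∨ m = n + 1 := by grind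
  · simp
  · push_cast
    rw [mul_div_cancel₀ _ (by positivity), sin_pi]

theorem sineWeight_ne_zero (n : ℕ) [NeZero n] : sineWeight n ≠ 0 := fun h => by
  have hn : 1 ≤ n := NeZero.one_le
  have hpos : 0 < sineWeight n 1 := by
    rw [sineWeight_eq_sin (by omega) (by omega), Int.cast_one, one_mul]
    refine sin_pos_of_pos_of_lt_pi (by positivity) (div_lt_self pi_pos ?_)
    have : (1 : ℝ) ≤ n := by exact_mod_cast hn
    linarith
  rw [h] at hpos
  exact lt_irrefl 0 hpos

theorem inner_shift_add_shift_neg_sineWeight (n : ℕ) :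
    inner ℝ (shift 1 (sineWeight n) + shift (-1) (sineWeight n)) (sineWeight n) =
      2 * cos (π / (n + 1)) * ‖sineWeight n‖ ^ 2 := by
  rw [← real_inner_self_eq_norm_sq, ← real_inner_smul_left, lp.inner_eq_tsum, lp.inner_eq_tsum]
  refine tsum_congr fun m => ?_
  by_cases h : m ∈ Finset.Icc 1 (n : ℤ)
  · congr 1
    change sineWeight n (m + 1) + sineWeight n (m + -1) =
      2 * cos (π / (n + 1)) * sineWeight n m
    rw [Finset.mem_Icc] at h
    rw [sineWeight_eq_sin (m := m + 1) (by omega) (by omega),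
      sineWeight_eq_sin (m := m + -1) (by omega) (by omega),
      sineWeight_eq_sin (m := m) (by omega) (by omega)]
    push_cast
    rw [add_mul, add_mul, one_mul, neg_one_mul, ← sub_eq_add_neg, sin_add, sin_sub]
    ring
  · rw [sineWeight_eq_zero m h, inner_zero_right, inner_zero_right]

theorem inner_shift_neg (d : ℤ) (p q : Ell ℝ) :
    inner ℝ (shift (-d) p) q = inner ℝ (shift d q) p := by
  rw [lp.inner_eq_tsum, lp.inner_eq_tsum, ← (Equiv.addRight d).tsum_eq]
  refine tsum_congr fun m => ?_
  rw [real_inner_comm, Equiv.coe_addRight, shift_apply, shift_apply, add_neg_cancel_right]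

theorem sin_pi_div_nonneg (n : ℕ) : 0 ≤ sin (π / (2 * ((n : ℝ) + 1))) := by
  refine sin_nonneg_of_nonneg_of_le_pi (by positivity) (div_le_self pi_pos.le ?_)
  have : (0 : ℝ) ≤ n := n.cast_nonneg
  linarith

theorem norm_shift_sub_sineWeight (n : ℕ) :
    ‖shift 1 (sineWeight n) - sineWeight n‖ =
      2 * sin (π / (2 * ((n : ℝ) + 1))) * ‖sineWeight n‖ := by
  have hinner : inner ℝ (shift 1 (sineWeight n)) (sineWeight n) =
      cos (π / (n + 1)) * ‖sineWeight n‖ ^ 2 := by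
    have h := inner_shift_add_shift_neg_sineWeight n
    rw [inner_add_left, inner_shift_neg] at h
    linarith
  have hangle : 2 * (π / (2 * ((n : ℝ) + 1))) = π / (n + 1) := by field_simp
  have hsin := sin_pi_div_nonneg n
  rw [← sq_eq_sq₀ (norm_nonneg _) (by positivity), norm_sub_sq_real, norm_shift, hinner, mul_pow,
    mul_pow, sin_sq_eq_half_sub, hangle]
  ring

end SineWeight

section Penalty

variable {Y : Type*} [NormedAddCommGroup Y] [NormedSpace ℂ Y]

theorem offDiag_nonneg (B : Op Y) : 0 ≤ offDiag B :=
  add_nonneg (Real.iSup_nonneg fun _ => norm_nonneg _) (Real.iSup_nonneg fun _ => norm_nonneg _)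

theorem penalty_nonneg (n : ℕ) (B : Op Y) : 0 ≤ penalty n B :=
  mul_nonneg (mul_nonneg zero_le_two (offDiag_nonneg B)) (sin_pi_div_nonneg n)

instance [Nontrivial Y] : Nontrivial (Ell Y) :=
  (AddMonoidHomClass.isometry_of_norm (embed (Y := Y) 0) (norm_embed 0)).injective.nontrivial

theorem le_lowerNorm_add_penalty [Nontrivial Y] {B : Op Y} (hB : IsTridiagonal B) {n : ℕ}
    [NeZero n] {c : ℝ} (hc : ∀ k, c ≤ lowerNormOn B (sectionSpace Y n k)) :
    c ≤ lowerNorm B + penalty n B := by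
  rcases lt_or_ge c 0 with hc0 | hc0
  · exact hc0.le.trans (add_nonneg (lowerNorm_nonneg B) (penalty_nonneg n B))
  rw [← sub_le_iff_le_add]
  refine le_lowerNorm fun x => ?_
  refine le_of_mul_le_mul_left ?_ (norm_pos_iff.2 (sineWeight_ne_zero n))
  have h := hB.mul_norm_le hc0 hc sineWeight_eq_zero x
  rw [norm_shift_sub_sineWeight] at h
  rw [penalty]
  linarith

theorem penalty_transpose (n : ℕ) (B : Op Y) : penalty n (transpose B) = penalty n B := by
  have hsup := (Equiv.addRight (1 : ℤ)).iSup_comp (g := fun i => ‖entry B i (i - 1)‖)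
  have hsub := (Equiv.subRight (1 : ℤ)).iSup_comp (g := fun i => ‖entry B i (i + 1)‖)
  simp only [Equiv.coe_addRight, Equiv.subRight_apply, add_sub_cancel_right, sub_add_cancel]
    at hsup hsub
  simp only [penalty, offDiag, entry_transpose, norm_dual, hsup, hsub, add_comm]

theorem penalty_subScalar (n : ℕ) (B : Op Y) (z : ℂ) :
    penalty n (subScalar B z) = penalty n B := by
  have hne (i : ℤ) : i ≠ i - 1 := by omega
  simp [penalty, offDiag, entry_subScalar, hne]

theorem offDiag_le (B : Op Y) : offDiag B ≤ 2 * ‖B‖ := by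
  rw [two_mul]
  exact add_le_add (ciSup_le fun i => norm_entry_le _ _ _) (ciSup_le fun i => norm_entry_le _ _ _)

end Penalty

/-! ### Regrouping -/

section Regroup

variable {X : Type*} [NormedAddCommGroup X] [NormedSpace ℂ X]

theorem norm_regroup (b : ℕ) [NeZero b] (B : Op X) : ‖regroup b B‖ = ‖B‖ :=
  ((blockIso X b).toLinearIsometry.norm_toContinuousLinearMap_comp).trans
    (B.opNorm_comp_linearIsometryEquiv (blockIso X b).symm)

theorem recipNormInv_subScalar_regroup (b : ℕ) [NeZero b] (B : Op X) (z : ℂ) :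
    recipNormInv (subScalar (regroup b B) z) = recipNormInv (subScalar B z) := by
  rw [← recipNormInv_conj (blockIso X b), conj_subScalar]
  rfl

theorem blockIso_symm_embed (b : ℕ) [NeZero b] (j : ℤ) (ξ : Pow X b) :
    (blockIso X b).symm (embed j ξ) = ∑ m, embed (blockIndex b (j, m)) (ξ m) := by
  rw [LinearIsometryEquiv.symm_apply_eq]
  ext i m'
  change embed j ξ i m' = (∑ m, embed (blockIndex b (j, m)) (ξ m)) (blockIndex b (i, m'))
  rw [← coord_apply (blockIndex b (i, m')), map_sum, embed_apply]
  simp only [coord_apply, embed_apply, (blockIndex b).injective.eq_iff, Prod.mk.injEq]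
  by_cases h : i = j <;> simp [h]

theorem entry_regroup (b : ℕ) [NeZero b] (B : Op X) (i j : ℤ) :
    entry (regroup b B) i j =
      ofEntries fun m m' => entry B (blockIndex b (i, m)) (blockIndex b (j, m')) := by
  ext ξ m
  rw [ofEntries_apply]
  change B ((blockIso X b).symm (embed j ξ)) (blockIndex b (i, m)) = _
  rw [blockIso_symm_embed, map_sum, ← coord_apply (blockIndex b (i, m)), map_sum]
  rfl

theorem HasBandwidth.isTridiagonal_regroup {B : Op X} {b : ℕ} [NeZero b] (hB : HasBandwidth B b) :
    IsTridiagonal (regroup b B) := by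
  intro i j hij
  have hfar (m m' : Fin b) : (b : ℤ) < |blockIndex b (i, m) - blockIndex b (j, m')| := by
    have hblocks : (b : ℤ) * 2 ≤ |b * (i - j)| := by
      rw [abs_mul, Nat.abs_cast]
      gcongr
      exact hij
    have hm := m.2
    have hm' := m'.2
    rw [blockIndex_apply, blockIndex_apply, lt_abs]
    rw [mul_sub, le_abs] at hblocks
    omega
  rw [entry_regroup]
  ext ξ m
  rw [ofEntries_apply]
  exact Finset.sum_eq_zero fun m' _ => by rw [hB _ _ (hfar m m'), zero_apply]

end Regroup

/-! ### Finite nets of truncations -/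

section Net

variable {Y : Type*} [NormedAddCommGroup Y] [NormedSpace ℂ Y]

theorem continuous_ofEntries {m n : ℕ} :
    Continuous fun M : Fin m → Fin n → (Y →L[ℂ] Y) => ofEntries M := by
  refine continuous_const.clm_comp ((ContinuousLinearMap.piEquivL ℂ ..).continuous.comp ?_)
  fun_prop

theorem isCompact_image_ofEntries {C : Set (Y →L[ℂ] Y)} (hC : IsCompact C) (m n : ℕ) :
    IsCompact (ofEntries '' {M : Fin m → Fin n → (Y →L[ℂ] Y) | ∀ r c, M r c ∈ C}) :=
  (isCompact_pi_infinite fun _ => isCompact_pi_infinite fun _ => hC).image continuous_ofEntries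

theorem continuous_dual : Continuous fun B : Y →L[ℂ] Y => dual B :=
  ((ContinuousLinearMap.compL ℂ Y Y ℂ).flip).continuous

theorem exists_finset_norm_sub_lt {ι E F : Type*} [SeminormedAddCommGroup E]
    [SeminormedAddCommGroup F] {f : ι → E} {g : ι → F} {C : Set E} {D : Set F} (hC : IsCompact C)
    (hD : IsCompact D) (hf : ∀ i, f i ∈ C) (hg : ∀ i, g i ∈ D) {r : ℝ} (hr : 0 < r) :
    ∃ K : Finset ι, ∀ k, ∃ j ∈ K, ‖f k - f j‖ < r ∧ ‖g k - g j‖ < r := by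
  classical
  have htb : TotallyBounded (range fun i => (f i, g i)) :=
    (hC.prod hD).totallyBounded.subset (range_subset_iff.2 fun i => mk_mem_prod (hf i) (hg i))
  obtain ⟨t, ht, htf, hcov⟩ := Metric.finite_approx_of_totallyBounded htb r hr
  lift t to Finset (E × F) using htf
  obtain ⟨K, -, rfl⟩ := Finset.subset_set_image_iff.1 (image_univ ▸ ht)
  refine ⟨K, fun k => ?_⟩
  simpa [Prod.dist_eq, dist_eq_norm, and_left_comm] using hcov (mem_range_self k)

theorem mem_image_ofEntries {C : Set (Y →L[ℂ] Y)} {m n : ℕ} {M : Fin m → Fin n → (Y →L[ℂ] Y)}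
    (hM : ∀ r c, M r c ∈ C) :
    ofEntries M ∈ ofEntries '' {M : Fin m → Fin n → (Y →L[ℂ] Y) | ∀ r c, M r c ∈ C} :=
  mem_image_of_mem ofEntries hM

theorem exists_isNet {B : Op Y} {C : Set (Y →L[ℂ] Y)} (hC : IsCompact C)
    (hB : ∀ i j, entry B i j ∈ C) (n : ℕ) [NeZero n] : ∃ K : Finset ℤ, IsNet n K B := by
  have hn : 0 < 1 / (n : ℝ) := one_div_pos.2 (Nat.cast_pos.2 (NeZero.pos n))
  obtain ⟨K, hK⟩ := exists_finset_norm_sub_lt (f := fun k => truncPlus n k B)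
    (g := fun k => truncPlusDual n k B) (isCompact_image_ofEntries hC (n + 2) n)
    (isCompact_image_ofEntries (hC.image continuous_dual) (n + 2) n)
    (fun k => mem_image_ofEntries fun _ _ => hB _ _)
    (fun k => mem_image_ofEntries fun _ _ => mem_image_of_mem dual (hB _ _)) hn
  exact ⟨K, fun k => (hK k).imp fun j hj => ⟨hj.1, hj.2.1.le, hj.2.2.le⟩⟩

theorem exists_isNet_regroup {B : Op Y}
    (hB : IsCompact (closure {a : Y →L[ℂ] Y | ∃ i j : ℤ, a = entry B i j})) (b : ℕ) [NeZero b]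
    (n : ℕ) [NeZero n] : ∃ K : Finset ℤ, IsNet n K (regroup b B) :=
  exists_isNet (isCompact_image_ofEntries hB b b)
    (fun i j => ⟨_, fun _ _ => subset_closure ⟨_, _, rfl⟩, (entry_regroup b B i j).symm⟩) n

theorem IsBandedApprox.isCompact_closure_entries {A : Op Y} {An : ℕ → Op Y}
    (hAn : IsBandedApprox A An)
    (hA : IsCompact (closure {a : Y →L[ℂ] Y | ∃ i j : ℤ, a = entry A i j})) {n : ℕ} (hn : 1 ≤ n) :
    IsCompact (closure {a : Y →L[ℂ] Y | ∃ i j : ℤ, a = entry (An n) i j}) := by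
  refine (((isCompact_Icc (a := (0 : ℝ)) (b := 1)).prod hA).image
    (f := fun q : ℝ × (Y →L[ℂ] Y) => (q.1 : ℂ) • q.2) (by fun_prop)).closure_of_subset ?_
  have hmem (i j : ℤ) := subset_closure (s := {a | ∃ i j : ℤ, a = entry A i j}) ⟨i, j, rfl⟩
  rintro _ ⟨i, j, rfl⟩
  rcases hAn with ⟨-, h⟩ | ⟨-, p, hp, h⟩
  · exact ⟨(1, entry A i j), ⟨by simp, hmem i j⟩, by simp [h n hn]⟩
  rw [h n hn]
  split_ifs with hij
  · have hquot : ((|i - j| : ℤ) : ℝ) / ((n : ℝ) + 1) ≤ 1 := by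
      have : ((|i - j| : ℤ) : ℝ) ≤ n := by exact_mod_cast hij
      rw [div_le_one (by positivity)]
      linarith
    have hquot0 : 0 ≤ ((|i - j| : ℤ) : ℝ) / ((n : ℝ) + 1) := by positivity
    exact ⟨(_, entry A i j), ⟨⟨Real.rpow_nonneg (sub_nonneg.2 hquot) p,
      Real.rpow_le_one (sub_nonneg.2 hquot) (sub_le_self _ hquot0) hp⟩, hmem i j⟩, rfl⟩
  · exact ⟨(0, entry A i j), ⟨by simp, hmem i j⟩, by simp⟩

end Net

/-! ### Lower norms on sections and the reciprocal norm of the inverse -/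

section MuFin

variable {Y : Type*} [NormedAddCommGroup Y] [NormedSpace ℂ Y]

instance [Nontrivial Y] {n : ℕ} [NeZero n] : Nontrivial (Pow Y n) :=
  (WithLp.equiv 2 (Fin n → Y)).nontrivial

instance [Nontrivial Y] {n : ℕ} [NeZero n] {k : ℤ} : Nontrivial (sectionSpace Y n k) :=
  (sectionIso Y n k).toEquiv.nontrivial

theorem IsNet.nonempty {n : ℕ} {K : Finset ℤ} {B : Op Y} (hK : IsNet n K B) : K.Nonempty := by
  obtain ⟨j, hj, -⟩ := hK 0
  exact ⟨j, hj⟩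

theorem truncPlus_subScalar_sub (B : Op Y) (n : ℕ) (k j : ℤ) (z : ℂ) :
    truncPlus n k (subScalar B z) - truncPlus n j (subScalar B z) =
      truncPlus n k B - truncPlus n j B := by
  rw [truncPlus_subScalar, truncPlus_subScalar, sub_sub_sub_cancel_right]

theorem IsNet.subScalar {n : ℕ} {K : Finset ℤ} {B : Op Y} (hK : IsNet n K B) (z : ℂ) :
    IsNet n K (subScalar B z) := by
  simpa only [IsNet, truncPlusDual_eq, transpose_subScalar, truncPlus_subScalar_sub] using hK

theorem recipNormInv_le_muFin [CompleteSpace Y] [Nontrivial Y] {n : ℕ} [NeZero n]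
    {K : Finset ℤ} (hK : K.Nonempty) (B : Op Y) : recipNormInv B ≤ muFin n K B := by
  have : Nonempty {k : ℤ // k ∈ K} := hK.to_subtype
  refine le_ciInf fun k => ?_
  rw [recipNormInv_eq_min, lowerNormOn_dual, ← lowerNorm_transpose]
  exact min_le_min (lowerNorm_le_lowerNormOn _ _) (lowerNorm_le_lowerNormOn _ _)

theorem muFin_le_min_lowerNorm_truncPlus {B : Op Y} (hB : IsTridiagonal B) (n : ℕ) {K : Finset ℤ}
    {j : ℤ} (hj : j ∈ K) :
    muFin n K B ≤ min (lowerNorm (truncPlus n j B)) (lowerNorm (truncPlus n j (transpose B))) := by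
  rw [← lowerNormOn_sectionSpace hB, ← lowerNormOn_sectionSpace hB.transpose, ← lowerNormOn_dual]
  exact ciInf_le (f := fun k : {k : ℤ // k ∈ K} => min (lowerNormOn B (sectionSpace Y n k))
    (lowerNormOn (dual B) (dualSectionSpace Y n k))) (finite_range _).bddBelow ⟨j, hj⟩

theorem le_lowerNorm_add_penalty_of_net [Nontrivial Y] {B : Op Y} (hB : IsTridiagonal B) {n : ℕ}
    [NeZero n] {K : Set ℤ} {c r : ℝ} (hK : ∀ k, ∃ j ∈ K, ‖truncPlus n k B - truncPlus n j B‖ ≤ r)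
    (hc : ∀ j ∈ K, c ≤ lowerNorm (truncPlus n j B)) : c ≤ lowerNorm B + penalty n B + r := by
  rw [← sub_le_iff_le_add]
  refine le_lowerNorm_add_penalty hB fun k => ?_
  obtain ⟨j, hj, hkj⟩ := hK k
  rw [lowerNormOn_sectionSpace hB, sub_le_iff_le_add]
  rw [norm_sub_rev] at hkj
  exact (hc j hj).trans ((lowerNorm_le_add_norm_sub _ _).trans (by gcongr))

theorem muFin_le [CompleteSpace Y] [Nontrivial Y] {B : Op Y} (hB : IsTridiagonal B) {n : ℕ}
    [NeZero n] {K : Finset ℤ} (hK : IsNet n K B) :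
    muFin n K B ≤ recipNormInv B + penalty n B + 1 / (n : ℝ) := by
  have hle := le_lowerNorm_add_penalty_of_net (K := K) hB
    (fun k => (hK k).imp fun j hj => ⟨hj.1, hj.2.1⟩)
    fun j hj => (muFin_le_min_lowerNorm_truncPlus hB n hj).trans (min_le_left _ _)
  have hle' := le_lowerNorm_add_penalty_of_net (K := K) hB.transpose
    (fun k => (hK k).imp fun j hj => ⟨hj.1, by simpa only [truncPlusDual_eq] using hj.2.2⟩)
    fun j hj => (muFin_le_min_lowerNorm_truncPlus hB n hj).trans (min_le_right _ _)
  rw [lowerNorm_transpose, penalty_transpose] at hle'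
  rw [recipNormInv_eq_min, ← min_add_add_right, ← min_add_add_right]
  exact le_min hle hle'

end MuFin

/-! ### Pseudospectra -/

section Pseudospectrum

variable {V : Type*} [NormedAddCommGroup V] [NormedSpace ℂ V]

theorem pseudospectrum_zero (A : V →L[ℂ] V) : pseudospectrum 0 A = spectrum ℂ A := if_pos rfl

variable [Nontrivial V]

theorem recipNormInv_pos_iff {B : V →L[ℂ] V} : 0 < recipNormInv B ↔ IsUnit B := by
  refine ⟨fun h => by_contra fun hB => ?_, ?_⟩
  · rw [recipNormInv, if_neg hB] at h
    exact lt_irrefl 0 h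
  · rintro ⟨u, rfl⟩
    rw [recipNormInv_units]
    exact one_div_pos.2 (norm_pos_iff.2 u⁻¹.ne_zero)

theorem mem_pseudospectrum {ε : ℝ} (hε : 0 ≤ ε) {A : V →L[ℂ] V} {z : ℂ} :
    z ∈ pseudospectrum ε A ↔ recipNormInv (subScalar A z) ≤ ε := by
  rcases eq_or_ne ε 0 with rfl | hε0
  · rw [pseudospectrum_zero, spectrum.mem_iff, IsUnit.sub_iff, ← not_lt, recipNormInv_pos_iff]
    rfl
  · rw [pseudospectrum, if_neg hε0, mem_ofPred_eq]

theorem pseudospectrum_mono {ε ε' : ℝ} (hε : 0 ≤ ε) (h : ε ≤ ε') (A : V →L[ℂ] V) :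
    pseudospectrum ε A ⊆ pseudospectrum ε' A := fun _ hz =>
  (mem_pseudospectrum (hε.trans h)).2 (((mem_pseudospectrum hε).1 hz).trans h)

variable [CompleteSpace V]

theorem recipNormInv_subScalar_le (A B : V →L[ℂ] V) (z : ℂ) :
    recipNormInv (subScalar A z) ≤ recipNormInv (subScalar B z) + ‖A - B‖ := by
  simpa only [subScalar, sub_sub_sub_cancel_right] using
    recipNormInv_le_add_norm_sub (subScalar A z) (subScalar B z)

theorem continuous_recipNormInv_subScalar (A : V →L[ℂ] V) :
    Continuous fun z => recipNormInv (subScalar A z) := by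
  refine (LipschitzWith.of_le_add fun z z' => ?_).continuous
  have hdist : ‖subScalar A z - subScalar A z'‖ = dist z z' := by
    rw [subScalar, subScalar, sub_sub_sub_cancel_left, ← sub_smul, norm_smul,
      ContinuousLinearMap.norm_id, mul_one, dist_comm, dist_eq_norm]
  exact hdist ▸ recipNormInv_le_add_norm_sub (subScalar A z) (subScalar A z')

theorem norm_le_recipNormInv_subScalar_add_norm (A : V →L[ℂ] V) (z : ℂ) :
    ‖z‖ ≤ recipNormInv (subScalar A z) + ‖A‖ := by
  have hzero : ‖z‖ ≤ recipNormInv (subScalar (0 : V →L[ℂ] V) z) := by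
    rw [recipNormInv_eq_min, dual_subScalar]
    refine le_min (le_lowerNorm fun x => ?_) (le_lowerNorm fun f => ?_) <;>
      simp [subScalar, dual, norm_smul]
  simpa using hzero.trans (recipNormInv_subScalar_le 0 A z)

theorem isCompact_pseudospectrum {ε : ℝ} (hε : 0 ≤ ε) (A : V →L[ℂ] V) :
    IsCompact (pseudospectrum ε A) := by
  have heq : pseudospectrum ε A = {z | recipNormInv (subScalar A z) ≤ ε} :=
    ext fun _ => mem_pseudospectrum hε
  refine Metric.isCompact_of_isClosed_isBounded ?_ ?_
  · rw [heq]
    exact isClosed_le (continuous_recipNormInv_subScalar A) continuous_const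
  · refine isBounded_iff_forall_norm_le.2 ⟨ε + ‖A‖, fun z hz => ?_⟩
    have hzε := (mem_pseudospectrum hε).1 hz
    exact (norm_le_recipNormInv_subScalar_add_norm A z).trans (by gcongr)

theorem pseudospectrum_nonempty {ε : ℝ} (hε : 0 ≤ ε) (A : V →L[ℂ] V) :
    (pseudospectrum ε A).Nonempty := by
  refine Nonempty.mono (pseudospectrum_mono le_rfl hε A) ?_
  rw [pseudospectrum_zero]
  exact spectrum.nonempty A

theorem exists_sublevel_subset_of_isCompact {α : Type*} [TopologicalSpace α] {f : α → ℝ}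
    (hf : Continuous f) {c c' : ℝ} (hc : c < c') (hcomp : IsCompact {x | f x ≤ c'}) {U : Set α}
    (hU : IsOpen U) (hcU : {x | f x ≤ c} ⊆ U) : ∃ d > c, {x | f x ≤ d} ⊆ U := by
  rcases ({x | f x ≤ c'} \ U).eq_empty_or_nonempty with hempty | hne
  · exact ⟨c', hc, sdiff_eq_empty.1 hempty⟩
  obtain ⟨x₀, hx₀, hmin⟩ := (hcomp.diff hU).exists_isMinOn hne hf.continuousOn
  have hcx₀ : c < f x₀ := not_le.1 fun hle => hx₀.2 (hcU hle)
  obtain ⟨d, hcd, hdx₀⟩ := exists_between hcx₀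
  refine ⟨d, hcd, fun x (hx : f x ≤ d) => by_contra fun hxU => ?_⟩
  have hle : f x₀ ≤ f x := hmin ⟨hx.trans (hdx₀.le.trans hx₀.1), hxU⟩
  linarith

theorem exists_pseudospectrum_subset_thickening {ε : ℝ} (hε : 0 ≤ ε) (A : V →L[ℂ] V) {ρ : ℝ}
    (hρ : 0 < ρ) :
    ∃ ε' > ε, pseudospectrum ε' A ⊆ Metric.thickening ρ (pseudospectrum ε A) := by
  have heq {σ : ℝ} (hσ : 0 ≤ σ) :
      {z | recipNormInv (subScalar A z) ≤ σ} = pseudospectrum σ A :=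
    ext fun _ => (mem_pseudospectrum hσ).symm
  obtain ⟨ε', hε', hsub⟩ := exists_sublevel_subset_of_isCompact
    (continuous_recipNormInv_subScalar A) (lt_add_one ε)
    (heq (hε.trans (lt_add_one ε).le) ▸ isCompact_pseudospectrum (by positivity) A)
    Metric.isOpen_thickening (heq hε ▸ Metric.self_subset_thickening hρ (pseudospectrum ε A))
  rw [heq hε, heq (hε.trans hε'.le)] at hsub
  exact ⟨ε', hε', hsub⟩

theorem hausdorffTendsto_pseudospectrum {ε : ℝ} (hε : 0 ≤ ε) (A : V →L[ℂ] V) {S : ℕ → Set ℂ}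
    {τ : ℕ → ℝ} (hτ0 : ∀ n, 1 ≤ n → 0 ≤ τ n) (hτ : Tendsto τ atTop (𝓝 0))
    (hsub : ∀ n, 1 ≤ n → pseudospectrum ε A ⊆ S n)
    (hsup : ∀ n, 1 ≤ n → S n ⊆ pseudospectrum (ε + τ n) A) :
    HausdorffTendsto S (pseudospectrum ε A) := by
  have hne := pseudospectrum_nonempty hε A
  have hbdd (n : ℕ) (hn : 1 ≤ n) : Bornology.IsBounded (S n) :=
    (isCompact_pseudospectrum (add_nonneg hε (hτ0 n hn)) A).isBounded.subset (hsup n hn)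
  refine ⟨fun n hn => ⟨hbdd n hn, hne.mono (hsub n hn)⟩,
    (isCompact_pseudospectrum hε A).isBounded, hne, ENNReal.tendsto_nhds_zero.2 fun r hr => ?_⟩
  rcases eq_or_ne r ⊤ with rfl | hr'
  · simp
  obtain ⟨ε', hε', hthick⟩ := exists_pseudospectrum_subset_thickening hε A
    (ENNReal.toReal_pos hr.ne' hr')
  filter_upwards [hτ.eventually_lt_const (sub_pos.2 hε'), eventually_ge_atTop 1] with n hτn hn
  refine Metric.hausdorffEDist_le_of_infEDist (fun z hz => ?_) fun z hz => ?_
  · have hz' : z ∈ pseudospectrum ε' A :=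
      pseudospectrum_mono (add_nonneg hε (hτ0 n hn)) (by linarith) A (hsup n hn hz)
    have hlt := Metric.mem_thickening_iff_infEDist_lt.1 (hthick hz')
    rw [ENNReal.ofReal_toReal hr'] at hlt
    exact hlt.le
  · rw [Metric.infEDist_zero_of_mem (hsub n hn hz)]
    exact zero_le

end Pseudospectrum

/-! ### Pseudospectra and finite sections -/

section Inclusions

variable {X : Type*} [NormedAddCommGroup X] [NormedSpace ℂ X]

theorem gammaFin_mono (n : ℕ) (K : Finset ℤ) {ε ε' : ℝ} (h : ε ≤ ε') (B : Op X) :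
    GammaFin n K ε B ⊆ GammaFin n K ε' B := fun _ hz => le_trans hz h

theorem tendsto_penalty_zero {Y : ℕ → Type*} [∀ n, NormedAddCommGroup (Y n)]
    [∀ n, NormedSpace ℂ (Y n)] {B : ∀ n, Op (Y n)} {C : ℝ} (hB : ∀ᶠ n in atTop, ‖B n‖ ≤ C) :
    Tendsto (fun n => penalty n (B n)) atTop (𝓝 0) := by
  have hdenom : Tendsto (fun n : ℕ => 2 * ((n : ℝ) + 1)) atTop atTop :=
    (tendsto_natCast_atTop_atTop.atTop_add tendsto_const_nhds).const_mul_atTop two_pos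
  have hangle := hdenom.const_div_atTop Real.pi
  have hbound : Tendsto (fun n : ℕ => 2 * (2 * C) * Real.sin (Real.pi / (2 * ((n : ℝ) + 1))))
      atTop (𝓝 0) := by
    simpa using! ((Real.continuous_sin.tendsto 0).comp hangle).const_mul (2 * (2 * C))
  refine squeeze_zero' (.of_forall fun n => penalty_nonneg n _) ?_ hbound
  filter_upwards [hB] with n hn
  have hsin := sin_pi_div_nonneg n
  rw [penalty]
  gcongr
  exact (offDiag_le _).trans (by gcongr)

theorem tendsto_penalty_regroup {A : Op X} {An : ℕ → Op X}
    (hδ : Tendsto (fun n => ‖A - An n‖) atTop (𝓝 0)) (w : ℕ → ℕ+) :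
    Tendsto (fun n => penalty n (regroup (w n) (An n))) atTop (𝓝 0) := by
  have hbound : ∀ᶠ n in atTop, ‖An n‖ ≤ ‖A‖ + 1 := by
    filter_upwards [hδ.eventually_lt_const zero_lt_one] with n hn
    have h := norm_sub_le A (A - An n)
    rw [sub_sub_cancel] at h
    linarith
  exact tendsto_penalty_zero (by simpa only [norm_regroup] using hbound)

variable [CompleteSpace X] [Nontrivial X]

theorem gammaFin_subset_pseudospectrum (A B : Op X) (b : ℕ) [NeZero b] {n : ℕ} [NeZero n]
    {K : Finset ℤ} (hK : K.Nonempty) {ε : ℝ} (hε : 0 ≤ ε) :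
    GammaFin n K ε (regroup b B) ⊆ pseudospectrum (ε + ‖A - B‖) A := by
  intro z hz
  rw [mem_pseudospectrum (by positivity)]
  calc recipNormInv (subScalar A z) ≤ recipNormInv (subScalar B z) + ‖A - B‖ :=
        recipNormInv_subScalar_le A B z
    _ = recipNormInv (subScalar (regroup b B) z) + ‖A - B‖ := by rw [recipNormInv_subScalar_regroup]
    _ ≤ ε + ‖A - B‖ := by
        gcongr
        exact (recipNormInv_le_muFin hK _).trans hz

theorem pseudospectrum_subset_gammaFin (A : Op X) {B : Op X} {b : ℕ} [NeZero b]
    (hB : HasBandwidth B b) {n : ℕ} [NeZero n] {K : Finset ℤ} (hK : IsNet n K (regroup b B))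
    {ε : ℝ} (hε : 0 ≤ ε) :
    pseudospectrum ε A ⊆
      GammaFin n K (ε + ‖A - B‖ + penalty n (regroup b B) + 1 / (n : ℝ)) (regroup b B) := by
  intro z hz
  calc muFin n K (subScalar (regroup b B) z)
      ≤ recipNormInv (subScalar (regroup b B) z) + penalty n (subScalar (regroup b B) z) +
          1 / (n : ℝ) := muFin_le (hB.isTridiagonal_regroup.subScalar z) (hK.subScalar z)
    _ = recipNormInv (subScalar B z) + penalty n (regroup b B) + 1 / (n : ℝ) := by
        rw [recipNormInv_subScalar_regroup, penalty_subScalar]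
    _ ≤ ε + ‖A - B‖ + penalty n (regroup b B) + 1 / (n : ℝ) := by
        gcongr
        rw [norm_sub_rev]
        exact (recipNormInv_subScalar_le B A z).trans
          (by gcongr; exact (mem_pseudospectrum hε).1 hz)

theorem hausdorffTendsto_gammaFin {A : Op X} {An : ℕ → Op X} {w : ℕ → ℕ+}
    (hw : ∀ n, 1 ≤ n → HasBandwidth (An n) (w n)) {r : ℕ → ℝ} (hr : Tendsto r atTop (𝓝 0))
    (hAr : ∀ n, ‖A - An n‖ ≤ r n) {K : ℕ → Finset ℤ}
    (hK : ∀ n, 1 ≤ n → IsNet n (K n) (regroup (w n) (An n))) {ε : ℝ} (hε : 0 ≤ ε) :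
    HausdorffTendsto
      (fun n => GammaFin n (K n) (ε + r n + penalty n (regroup (w n) (An n)) + 1 / (n : ℝ))
        (regroup (w n) (An n)))
      (pseudospectrum ε A) := by
  have hδ : Tendsto (fun n => ‖A - An n‖) atTop (𝓝 0) :=
    squeeze_zero (fun _ => norm_nonneg _) hAr hr
  have hr0 (n : ℕ) : 0 ≤ r n := (norm_nonneg _).trans (hAr n)
  have hpen (n : ℕ) := penalty_nonneg n (regroup (w n) (An n))
  refine hausdorffTendsto_pseudospectrum hε A
    (τ := fun n => r n + penalty n (regroup (w n) (An n)) + 1 / (n : ℝ) + ‖A - An n‖)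
    (fun n _ => ?_) ?_ (fun n hn => ?_) fun n hn => ?_
  · have := hr0 n
    have := hpen n
    positivity
  · simpa using ((hr.add (tendsto_penalty_regroup hδ w)).add
      tendsto_one_div_atTop_nhds_zero_nat).add hδ
  · have : NeZero n := ⟨by omega⟩
    refine (pseudospectrum_subset_gammaFin A (hw n hn) (hK n hn) hε).trans
      (gammaFin_mono _ _ ?_ _)
    gcongr
    exact hAr n
  · have : NeZero n := ⟨by omega⟩
    have h0 : 0 ≤ ε + r n + penalty n (regroup (w n) (An n)) + 1 / (n : ℝ) := by
      have := hr0 n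
      have := hpen n
      positivity
    simpa only [add_assoc] using
      gammaFin_subset_pseudospectrum A (An n) (w n) (hK n hn).nonempty h0

end Inclusions

end BandDom

end

open BandDom in
theorem theorem6p1_general {X : Type*} [NormedAddCommGroup X] [NormedSpace ℂ X] [CompleteSpace X]
    [Nontrivial X] (A : Op X) (An : ℕ → Op X)
    (hcomp : ∀ n, 1 ≤ n → IsCompact (closure {a : X →L[ℂ] X | ∃ i j : ℤ, a = entry (An n) i j}))
    (hδ : Tendsto (fun n => ‖A - An n‖) atTop (𝓝 0))
    (w : ℕ → ℕ+) (hw : ∀ n, 1 ≤ n → HasBandwidth (An n) (w n))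
    (η : ℕ → ℝ) (hη0 : ∀ n, 0 ≤ η n) (hη : Tendsto η atTop (𝓝 0)) :
    (∀ n : ℕ, 1 ≤ n → ∃ K : Finset ℤ, IsNet n K (regroup (w n) (An n))) ∧
    (∀ n : ℕ, 1 ≤ n → ∀ K : Finset ℤ, IsNet n K (regroup (w n) (An n)) →
      (∀ z : ℂ, muFin n K (subScalar (regroup (w n) (An n)) z) =
        muFinMat n K (regroup (w n) (An n)) z) ∧
      ∀ ε : ℝ, 0 ≤ ε →
        GammaFin n K ε (regroup (w n) (An n)) ⊆ pseudospectrum (ε + ‖A - An n‖ + η n) A ∧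
        pseudospectrum ε A ⊆
          GammaFin n K
            (ε + ‖A - An n‖ + η n + penalty n (regroup (w n) (An n)) + 1 / (n : ℝ))
            (regroup (w n) (An n))) ∧
    ∀ K : ℕ → Finset ℤ, (∀ n, 1 ≤ n → IsNet n (K n) (regroup (w n) (An n))) →
      (∀ ε : ℝ, 0 ≤ ε →
        HausdorffTendsto
          (fun n => GammaFin n (K n)
            (ε + 2 * ‖A - An n‖ + 2 * η n + penalty n (regroup (w n) (An n)) + 1 / (n : ℝ))
            (regroup (w n) (An n)))
          (pseudospectrum ε A)) ∧
      HausdorffTendsto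
        (fun n => GammaFin n (K n)
          (penalty n (regroup (w n) (An n)) + 2 * ‖A - An n‖ + 2 * η n + 1 / (n : ℝ))
          (regroup (w n) (An n)))
        (spectrum ℂ A) := by
  have hlim {K : ℕ → Finset ℤ} (hK : ∀ n, 1 ≤ n → IsNet n (K n) (regroup (w n) (An n))) {ε : ℝ}
      (hε : 0 ≤ ε) :=
    hausdorffTendsto_gammaFin hw (r := fun n => 2 * ‖A - An n‖ + 2 * η n)
      (by simpa using (hδ.const_mul 2).add (hη.const_mul 2))
      (fun n => by linarith [norm_nonneg (A - An n), hη0 n]) hK hε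
  refine ⟨fun n hn => ?_, fun n hn K hK => ⟨fun z => ?_, fun ε hε => ⟨?_, ?_⟩⟩,
    fun K hK => ⟨fun ε hε => ?_, ?_⟩⟩
  · have : NeZero n := ⟨by omega⟩
    exact exists_isNet_regroup (hcomp n hn) (w n) n
  · exact muFin_subScalar (hw n hn).isTridiagonal_regroup n K z
  · have : NeZero n := ⟨by omega⟩
    exact (gammaFin_subset_pseudospectrum A (An n) (w n) hK.nonempty hε).trans
      (pseudospectrum_mono (by positivity) (le_add_of_nonneg_right (hη0 n)) A)
  · have : NeZero n := ⟨by omega⟩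
    refine (pseudospectrum_subset_gammaFin A (hw n hn) hK hε).trans (gammaFin_mono n K ?_ _)
    linarith [hη0 n]
  · simpa only [add_assoc] using hlim hK hε
  · rw [← pseudospectrum_zero]
    convert! hlim hK le_rfl using 3 with n
    ring

open BandDom in
theorem theorem6p1 {X : Type*} [NormedAddCommGroup X] [NormedSpace ℂ X] [CompleteSpace X]
    [Nontrivial X]
    (A : Op X) (hA : A ∈ bandDominatedOps X)
    (hcomp : IsCompact (closure {a : X →L[ℂ] X | ∃ i j : ℤ, a = entry A i j}))
    (An : ℕ → Op X) (hAn : IsBandedApprox A An)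
    (hδ : Tendsto (fun n => ‖A - An n‖) atTop (𝓝 0))
    (w : ℕ → ℕ+) (hw : ∀ n, 1 ≤ n → HasBandwidth (An n) (w n))
    (η : ℕ → ℝ)
    (hη : ((FiniteDimensional ℂ X ∨ IsHilbertNorm X) ∧ ∀ n, η n = 0) ∨
      ((∀ n, 0 < η n) ∧ Tendsto η atTop (𝓝 0))) :
    (∀ n : ℕ, 1 ≤ n → ∃ K : Finset ℤ, IsNet n K (regroup (w n) (An n))) ∧
    (∀ n : ℕ, 1 ≤ n → ∀ K : Finset ℤ, IsNet n K (regroup (w n) (An n)) →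
      (∀ z : ℂ, muFin n K (subScalar (regroup (w n) (An n)) z) =
        muFinMat n K (regroup (w n) (An n)) z) ∧
      ∀ ε : ℝ, 0 ≤ ε →
        GammaFin n K ε (regroup (w n) (An n)) ⊆ pseudospectrum (ε + ‖A - An n‖ + η n) A ∧
        pseudospectrum ε A ⊆
          GammaFin n K
            (ε + ‖A - An n‖ + η n + penalty n (regroup (w n) (An n)) + 1 / (n : ℝ))
            (regroup (w n) (An n))) ∧
    ∀ K : ℕ → Finset ℤ, (∀ n, 1 ≤ n → IsNet n (K n) (regroup (w n) (An n))) →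
      (∀ ε : ℝ, 0 ≤ ε →
        HausdorffTendsto
          (fun n => GammaFin n (K n)
            (ε + 2 * ‖A - An n‖ + 2 * η n + penalty n (regroup (w n) (An n)) + 1 / (n : ℝ))
            (regroup (w n) (An n)))
          (pseudospectrum ε A)) ∧
      HausdorffTendsto
        (fun n => GammaFin n (K n)
          (penalty n (regroup (w n) (An n)) + 2 * ‖A - An n‖ + 2 * η n + 1 / (n : ℝ))
          (regroup (w n) (An n)))
        (spectrum ℂ A) := by
  have hη0 : ∀ n, 0 ≤ η n := hη.elim (fun h n => (h.2 n).ge) fun h n => (h.1 n).le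
  have hη_lim : Tendsto η atTop (𝓝 0) :=
    hη.elim (fun h => tendsto_const_nhds.congr fun n => (h.2 n).symm) And.right
  exact theorem6p1_general A An (fun n hn => hAn.isCompact_closure_entries hcomp hn) hδ w hw η hη0
    hη_lim
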